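/- Let $\Bbbk$ be a field. A GD-algebra (Gelfand--Dorfman bialgebra) over $\Bbbk$ is a linear space $A$ with two bilinear operations $\circ$ and $[\cdot,\cdot]$ such that $(A,[\cdot,\cdot])$ is a Lie algebra, $(A,\circ)$ is a Novikov algebra, i.e. $(a\circ b)\circ c-a\circ(b\circ c)=(b\circ a)\circ c-b\circ(a\circ c)$ and $(a\circ b)\circ c=(a\circ c)\circ b$, and $[a,b\circ c]-[c,b\circ a]+[b,a]\circ c-[b,c]\circ a-b\circ[a,c]=0$ for all $a,b,c\in A$. If $V$ is a (not necessarily unital) Poisson algebra with a linear map $d$ that is a derivation of both the commutative product and the bracket $\{\cdot,\cdot\}$, then $V$ is a GD-algebra with respect to $x\circ y=x\,d(y)$ and $[x,y]=\{x,y\}$. A GD-algebra is called special if it embeds (as a GD-algebra) into such a $V$. Let $\mathrm{SGD}$ be the variety generated by the special GD-algebras, i.e. the class of all homomorphic images of special GD-algebras. For $n\ge 1$ let $M_n$ be the space of all multilinear non-associative polynomials of degree $n$ in $x_1,\dots,x_n$ in the two operations $\circ$ and $[\cdot,\cdot]$ (spanned by the monomials in which each of $x_1,\dots,x_n$ occurs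 exactly once), and let $\mathrm{SGD}(n)$ be the quotient of $M_n$ by the subspace of those polynomials that are identities on all algebras in $\mathrm{SGD}$; thus $\mathrm{SGD}(n)$ is the $n$-th component of the operad governing $\mathrm{SGD}$. Then for every $n\ge 1$ $$\dim_{\Bbbk} \mathrm{SGD}(n)=\sum_{k=1}^n \frac{(n+k-2)!}{(k-1)!}\,H(n,k),$$ where $H(n,1)=1$ and $$H(n,k)=\sum_{1\le d_1<\dots<d_{k-1}\le n-1}\frac{1}{d_1\cdots d_{k-1}}\qquad (k\ge 2).$$ In particular, for $n=1,\dots,7$ the dimensions are $1, 3, 17, 130, 1219, 13391, 167656$. -/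

import Mathlib

universe u

/-- A Gelfand--Dorfman algebra structure on the `𝕜`-linear space `A`: a bilinear product `∘`
(`circ`) which is a Novikov product, a Lie bracket `[·,·]` (`brk`), and one compatibility
identity between them. -/
structure GDAlgebra (𝕜 A : Type u) [Field 𝕜] [AddCommGroup A] [Module 𝕜 A] where
  /-- the product `a ∘ b` -/
  circ : A →ₗ[𝕜] A →ₗ[𝕜] A
  /-- the bracket `[a, b]` -/
  brk : A →ₗ[𝕜] A →ₗ[𝕜] A
  left_symm : ∀ a b c : A,
    circ (circ a b) c - circ a (circ b c) = circ (circ b a) c - circ b (circ a c)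
  right_comm : ∀ a b c : A, circ (circ a b) c = circ (circ a c) b
  brk_self : ∀ a : A, brk a a = 0
  jacobi : ∀ a b c : A, brk a (brk b c) + brk b (brk c a) + brk c (brk a b) = 0
  compat : ∀ a b c : A,
    brk a (circ b c) - brk c (circ b a) + circ (brk b a) c - circ (brk b c) a
      - circ b (brk a c) = 0

/-- A differential Poisson algebra structure on the `𝕜`-linear space `V`: an associative and
commutative product (no identity element is required), a Lie bracket satisfying the Leibniz
identity, and a linear map `d` which is a derivation of both operations. -/
structure DiffPoissonAlgebra (𝕜 V : Type u) [Field 𝕜] [AddCommGroup V] [Module 𝕜 V] where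
  /-- the commutative product `x y` -/
  mul : V →ₗ[𝕜] V →ₗ[𝕜] V
  /-- the Poisson bracket `{x, y}` -/
  brk : V →ₗ[𝕜] V →ₗ[𝕜] V
  /-- the derivation -/
  d : V →ₗ[𝕜] V
  mul_assoc : ∀ x y z : V, mul (mul x y) z = mul x (mul y z)
  mul_comm : ∀ x y : V, mul x y = mul y x
  brk_self : ∀ x : V, brk x x = 0
  jacobi : ∀ x y z : V, brk x (brk y z) + brk y (brk z x) + brk z (brk x y) = 0
  leibniz : ∀ x y z : V, brk x (mul y z) = mul (brk x y) z + mul y (brk x z)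
  d_mul : ∀ x y : V, d (mul x y) = mul (d x) y + mul x (d y)
  d_brk : ∀ x y : V, d (brk x y) = brk (d x) y + brk x (d y)

namespace DiffPoissonAlgebra

variable {𝕜 V : Type u} [Field 𝕜] [AddCommGroup V] [Module 𝕜 V]

theorem brk_antisymm (P : DiffPoissonAlgebra 𝕜 V) (x y : V) : P.brk x y = -P.brk y x := by
  have h := P.brk_self (x + y)
  simp only [map_add, LinearMap.add_apply, P.brk_self, zero_add, add_zero] at h
  exact eq_neg_of_add_eq_zero_right h

theorem mul_right_comm (P : DiffPoissonAlgebra 𝕜 V) (x y z : V) :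
    P.mul (P.mul x y) z = P.mul (P.mul x z) y := by
  rw [P.mul_assoc, P.mul_comm y z, ← P.mul_assoc]

/-- The Gelfand--Dorfman algebra of a differential Poisson algebra: the bracket is kept, and
`x ∘ y = x d(y)`. -/
def toGD (P : DiffPoissonAlgebra 𝕜 V) : GDAlgebra 𝕜 V where
  circ := P.mul.compl₂ P.d
  brk := P.brk
  left_symm a b c := by
    simp only [LinearMap.compl₂_apply, P.d_mul, map_add, P.mul_assoc]
    rw [← P.mul_assoc a b, ← P.mul_assoc b a, P.mul_comm a b]
    abel
  right_comm a b c := by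
    simp only [LinearMap.compl₂_apply]
    exact P.mul_right_comm _ _ _
  brk_self := P.brk_self
  jacobi := P.jacobi
  compat a b c := by
    simp only [LinearMap.compl₂_apply, P.leibniz, P.d_brk, map_add]
    rw [P.brk_antisymm b a, P.brk_antisymm b c, P.brk_antisymm c (P.d a)]
    simp only [map_neg, LinearMap.neg_apply]
    abel

end DiffPoissonAlgebra

namespace GDAlgebra

variable {𝕜 A B : Type u} [Field 𝕜] [AddCommGroup A] [Module 𝕜 A] [AddCommGroup B] [Module 𝕜 B]

/-- A linear map is a homomorphism of GD-algebras if it preserves both operations. -/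
def IsHom (G : GDAlgebra 𝕜 A) (K : GDAlgebra 𝕜 B) (f : A →ₗ[𝕜] B) : Prop :=
  (∀ a b : A, f (G.circ a b) = K.circ (f a) (f b)) ∧
    ∀ a b : A, f (G.brk a b) = K.brk (f a) (f b)

/-- A GD-algebra is special if it embeds into the GD-algebra of a differential Poisson
algebra. -/
def IsSpecial (G : GDAlgebra 𝕜 A) : Prop :=
  ∃ (V : Type u) (_ : AddCommGroup V) (_ : Module 𝕜 V) (P : DiffPoissonAlgebra 𝕜 V)
    (f : A →ₗ[𝕜] V), G.IsHom P.toGD f ∧ Function.Injective f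

/-- Membership in the variety `SGD` generated by the special GD-algebras, that is, in the class
of all homomorphic images of special GD-algebras. -/
def IsSGD (G : GDAlgebra 𝕜 A) : Prop :=
  ∃ (S : Type u) (_ : AddCommGroup S) (_ : Module 𝕜 S) (K : GDAlgebra 𝕜 S) (f : S →ₗ[𝕜] A),
    K.IsSpecial ∧ K.IsHom G f ∧ Function.Surjective f

end GDAlgebra

/-- Non-associative monomials in the operations `∘` and `[·,·]` in the countable set of variables
`x₁, x₂, …`; the variable `xᵢ₊₁` is `var i`. -/
inductive GDMonomial : Type
  | var (i : ℕ) : GDMonomial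
  | circ (s t : GDMonomial) : GDMonomial
  | brk (s t : GDMonomial) : GDMonomial

namespace GDMonomial

/-- The variables which occur in a monomial, with multiplicities. -/
def vars : GDMonomial → Multiset ℕ
  | var i => {i}
  | circ s t => s.vars + t.vars
  | brk s t => s.vars + t.vars

/-- The value of a monomial under a substitution of elements of a GD-algebra for the variables. -/
def eval {𝕜 A : Type u} [Field 𝕜] [AddCommGroup A] [Module 𝕜 A] (G : GDAlgebra 𝕜 A)
    (σ : ℕ → A) : GDMonomial → A
  | var i => σ i
  | circ s t => G.circ (eval G σ s) (eval G σ t)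
  | brk s t => G.brk (eval G σ s) (eval G σ t)

end GDMonomial

/-- Non-associative polynomials in the operations `∘` and `[·,·]`: formal linear combinations of
monomials. -/
def GDPolynomial (𝕜 : Type u) [Field 𝕜] : Type u := GDMonomial →₀ 𝕜

namespace GDPolynomial

noncomputable instance (𝕜 : Type u) [Field 𝕜] : AddCommGroup (GDPolynomial 𝕜) :=
  inferInstanceAs (AddCommGroup (GDMonomial →₀ 𝕜))

noncomputable instance (𝕜 : Type u) [Field 𝕜] : Module 𝕜 (GDPolynomial 𝕜) :=
  inferInstanceAs (Module 𝕜 (GDMonomial →₀ 𝕜))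

/-- The value of a polynomial under a substitution of elements of a GD-algebra. -/
noncomputable def eval {𝕜 A : Type u} [Field 𝕜] [AddCommGroup A] [Module 𝕜 A]
    (G : GDAlgebra 𝕜 A) (σ : ℕ → A) : GDPolynomial 𝕜 →ₗ[𝕜] A :=
  Finsupp.linearCombination 𝕜 (GDMonomial.eval G σ)

/-- The space `M_n(X)` of multilinear polynomials of degree `n` in `x₁, …, xₙ`, spanned by the
monomials in which each of `x₁, …, xₙ` occurs exactly once and no other variable occurs. -/
def multilinear (𝕜 : Type u) [Field 𝕜] (n : ℕ) : Submodule 𝕜 (GDPolynomial 𝕜) :=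
  Finsupp.supported 𝕜 𝕜 {t : GDMonomial | t.vars = Multiset.range n}

/-- The T-ideal of all identities that hold on the variety `SGD`. -/
def idealSGD (𝕜 : Type u) [Field 𝕜] : Submodule 𝕜 (GDPolynomial 𝕜) where
  carrier := {f | ∀ (A : Type u) [AddCommGroup A] [Module 𝕜 A] (G : GDAlgebra 𝕜 A), G.IsSGD →
    ∀ σ : ℕ → A, eval G σ f = 0}
  zero_mem' := by
    intro A _ _ G _ σ
    exact map_zero _
  add_mem' := by
    intro f g hf hg A _ _ G hG σ
    rw [map_add, hf A G hG σ, hg A G hG σ, add_zero]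
  smul_mem' := by
    intro c f hf A _ _ G hG σ
    rw [map_smul, hf A G hG σ, smul_zero]

end GDPolynomial

/-- The `n`-th component of the operad `SGD`: multilinear polynomials of degree `n` modulo those
which are identities on the variety `SGD`. -/
abbrev SGD (𝕜 : Type u) [Field 𝕜] (n : ℕ) : Type u :=
  GDPolynomial.multilinear 𝕜 n ⧸
    (GDPolynomial.idealSGD 𝕜).comap (GDPolynomial.multilinear 𝕜 n).subtype

/-- `H(n,k)`: the sum of `1 / (d₁ ⋯ dₖ₋₁)` over `1 ≤ d₁ < ⋯ < dₖ₋₁ ≤ n - 1`, that is, over the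
`(k-1)`-element subsets of `{1, …, n-1}`. For `k = 1` this is the empty product `1`. -/
def sgdH (n k : ℕ) : ℚ :=
  ∑ s ∈ (Finset.Icc 1 (n - 1)).powersetCard (k - 1), ∏ d ∈ s, (1 / (d : ℚ))

/-! A polynomial is an identity of SGD exactly when it vanishes at the generators of the free
differential Poisson algebra (`mem_idealSGD_iff`). So SGD(n) is the multilinear part of the
GD-subalgebra generated by those generators.

Give a product of m+1 Lie monomials in derivatives of generators, with t derivations in all, the
weight t-m-1. Both x d(y) and {x,y} preserve weight -1. Conversely, every element of weight -1 is a
value of GD-polynomials (`gdSpan_eq_weightSpan`). The converse needs no explicit rewriting: an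
element of weight t-1 is characterized by what happens when it is multiplied by t GD-elements, and
the Leibniz rules show that this property behaves well under all three operations.

A multilinear Lie monomial is a combination of right-normed ones whose innermost letter has the
smallest index. Listing such factors by increasing last letter gives a word whose right-to-left
minima are the block ends, so words encode normal monomials. They span
(`gdSpan_eq_span_normalMonomial`). They are independent because in the polynomial ring on words,
with {u,v} = uv - vu, a right-normed bracket contains exactly one word ending in its minimum.

Weight -1 means that k minima come with k-1 derivations spread over n letters. The count is
therefore the sum of c(n,k) C(n+k-2,k-1), with c(n,k) = (n-1)! H(n,k) the Stirling numbers of the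
first kind. -/

/-- Monomials in the operations of a differential Poisson algebra. -/
inductive DPTerm : Type
  | var (i : ℕ) : DPTerm
  | mul (s t : DPTerm) : DPTerm
  | brk (s t : DPTerm) : DPTerm
  | d (s : DPTerm) : DPTerm

/-! ### Homomorphisms and the free differential Poisson algebra -/

namespace DiffPoissonAlgebra

variable {𝕜 V W : Type u} [Field 𝕜] [AddCommGroup V] [Module 𝕜 V] [AddCommGroup W] [Module 𝕜 W]

/-- A linear map is a homomorphism of differential Poisson algebras if it preserves the product,
the bracket and the derivation. -/
structure IsHom (P : DiffPoissonAlgebra 𝕜 V) (Q : DiffPoissonAlgebra 𝕜 W) (f : V →ₗ[𝕜] W) :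
    Prop where
  map_mul : ∀ a b, f (P.mul a b) = Q.mul (f a) (f b)
  map_brk : ∀ a b, f (P.brk a b) = Q.brk (f a) (f b)
  map_d : ∀ a, f (P.d a) = Q.d (f a)

/-- The value of a differential Poisson monomial. -/
def termValue (P : DiffPoissonAlgebra 𝕜 V) (x : ℕ → V) : DPTerm → V
  | .var i => x i
  | .mul s t => P.mul (termValue P x s) (termValue P x t)
  | .brk s t => P.brk (termValue P x s) (termValue P x t)
  | .d s => P.d (termValue P x s)

/-- The value of a differential Poisson polynomial. -/
noncomputable def evalPoly (P : DiffPoissonAlgebra 𝕜 V) (x : ℕ → V) : (DPTerm →₀ 𝕜) →ₗ[𝕜] V :=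
  Finsupp.linearCombination 𝕜 (termValue P x)

end DiffPoissonAlgebra

namespace FreeDP

open DiffPoissonAlgebra

variable (𝕜 : Type u) [Field 𝕜]

/-- The bilinear extension of a binary operation on monomials. -/
noncomputable def bilin (op : DPTerm → DPTerm → DPTerm) :
    (DPTerm →₀ 𝕜) →ₗ[𝕜] (DPTerm →₀ 𝕜) →ₗ[𝕜] (DPTerm →₀ 𝕜) :=
  Finsupp.linearCombination 𝕜
    (fun s => Finsupp.linearCombination 𝕜 (fun t => Finsupp.single (op s t) (1 : 𝕜)))

/-- The linear extension of the derivation on monomials. -/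
noncomputable def lin : (DPTerm →₀ 𝕜) →ₗ[𝕜] (DPTerm →₀ 𝕜) :=
  Finsupp.linearCombination 𝕜 (fun s => Finsupp.single (DPTerm.d s) (1 : 𝕜))

variable {𝕜}

theorem eval_bilin {V : Type u} [AddCommGroup V] [Module 𝕜 V] (P : DiffPoissonAlgebra 𝕜 V)
    (x : ℕ → V) (op : DPTerm → DPTerm → DPTerm) (B : V →ₗ[𝕜] V →ₗ[𝕜] V)
    (h : ∀ s t, termValue P x (op s t) = B (termValue P x s) (termValue P x t))
    (f g : DPTerm →₀ 𝕜) : evalPoly P x (bilin 𝕜 op f g) = B (evalPoly P x f) (evalPoly P x g) := by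
  have : (bilin 𝕜 op).compr₂ (evalPoly P x) = B.compl₁₂ (evalPoly P x) (evalPoly P x) := by
    ext s t
    simp [bilin, evalPoly, h]
  exact LinearMap.congr_fun (LinearMap.congr_fun this f) g

theorem eval_mul {V : Type u} [AddCommGroup V] [Module 𝕜 V] (P : DiffPoissonAlgebra 𝕜 V)
    (x : ℕ → V) (f g : DPTerm →₀ 𝕜) :
    evalPoly P x (bilin 𝕜 .mul f g) = P.mul (evalPoly P x f) (evalPoly P x g) :=
  eval_bilin P x _ _ (fun _ _ => rfl) f g

theorem eval_brk {V : Type u} [AddCommGroup V] [Module 𝕜 V] (P : DiffPoissonAlgebra 𝕜 V)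
    (x : ℕ → V) (f g : DPTerm →₀ 𝕜) :
    evalPoly P x (bilin 𝕜 .brk f g) = P.brk (evalPoly P x f) (evalPoly P x g) :=
  eval_bilin P x _ _ (fun _ _ => rfl) f g

theorem eval_d {V : Type u} [AddCommGroup V] [Module 𝕜 V] (P : DiffPoissonAlgebra 𝕜 V)
    (x : ℕ → V) (f : DPTerm →₀ 𝕜) : evalPoly P x (lin 𝕜 f) = P.d (evalPoly P x f) := by
  have : (evalPoly P x) ∘ₗ (lin 𝕜) = P.d ∘ₗ (evalPoly P x) := by
    ext s
    simp [lin, evalPoly, termValue]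
  exact LinearMap.congr_fun this f

variable (𝕜) in
/-- The identities that hold in all differential Poisson algebras. -/
def identities : Submodule 𝕜 (DPTerm →₀ 𝕜) where
  carrier := {f | ∀ (V : Type u) [AddCommGroup V] [Module 𝕜 V] (P : DiffPoissonAlgebra 𝕜 V)
    (x : ℕ → V), evalPoly P x f = 0}
  zero_mem' := by
    intro V _ _ P x
    exact map_zero _
  add_mem' := by
    intro f g hf hg V _ _ P x
    rw [map_add, hf V P x, hg V P x, add_zero]
  smul_mem' := by
    intro c f hf V _ _ P x
    rw [map_smul, hf V P x, smul_zero]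

variable (𝕜) in
/-- The underlying space of the free differential Poisson algebra. -/
abbrev Carrier : Type u := (DPTerm →₀ 𝕜) ⧸ identities 𝕜

/-- A bilinear map on polynomials that preserves identities descends to the quotient. -/
noncomputable def descend (B : (DPTerm →₀ 𝕜) →ₗ[𝕜] (DPTerm →₀ 𝕜) →ₗ[𝕜] (DPTerm →₀ 𝕜))
    (hl : ∀ f ∈ identities 𝕜, ∀ g, B f g ∈ identities 𝕜)
    (hr : ∀ g ∈ identities 𝕜, ∀ f, B f g ∈ identities 𝕜) :
    Carrier 𝕜 →ₗ[𝕜] Carrier 𝕜 →ₗ[𝕜] Carrier 𝕜 :=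
  ((identities 𝕜).liftQ ((identities 𝕜).liftQ (B.compr₂ (identities 𝕜).mkQ) (by
      intro f hf
      refine LinearMap.ext fun g => ?_
      simpa using hl f hf g)).flip (by
    intro g hg
    refine LinearMap.ext fun f => ?_
    obtain ⟨f, rfl⟩ := (identities 𝕜).mkQ_surjective f
    exact (Submodule.Quotient.mk_eq_zero _).2 (hr g hg f))).flip

/-- Multiplication in the free differential Poisson algebra. -/
noncomputable def mul : Carrier 𝕜 →ₗ[𝕜] Carrier 𝕜 →ₗ[𝕜] Carrier 𝕜 :=
  descend (bilin 𝕜 .mul)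
    (fun f hf g V _ _ P x => by rw [eval_mul, hf V P x, map_zero, LinearMap.zero_apply])
    (fun g hg f V _ _ P x => by rw [eval_mul, hg V P x, map_zero])

/-- The bracket of the free differential Poisson algebra. -/
noncomputable def brk : Carrier 𝕜 →ₗ[𝕜] Carrier 𝕜 →ₗ[𝕜] Carrier 𝕜 :=
  descend (bilin 𝕜 .brk)
    (fun f hf g V _ _ P x => by rw [eval_brk, hf V P x, map_zero, LinearMap.zero_apply])
    (fun g hg f V _ _ P x => by rw [eval_brk, hg V P x, map_zero])

/-- The derivation of the free differential Poisson algebra. -/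
noncomputable def d : Carrier 𝕜 →ₗ[𝕜] Carrier 𝕜 :=
  (identities 𝕜).mapQ (identities 𝕜) (lin 𝕜)
    (fun f hf V _ _ P x => by rw [eval_d, hf V P x, map_zero])

theorem mul_mkQ (f g : DPTerm →₀ 𝕜) : mul ((identities 𝕜).mkQ f) ((identities 𝕜).mkQ g) =
    (identities 𝕜).mkQ (bilin 𝕜 .mul f g) := rfl

theorem brk_mkQ (f g : DPTerm →₀ 𝕜) : brk ((identities 𝕜).mkQ f) ((identities 𝕜).mkQ g) =
    (identities 𝕜).mkQ (bilin 𝕜 .brk f g) := rfl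

theorem d_mkQ (f : DPTerm →₀ 𝕜) : d ((identities 𝕜).mkQ f) = (identities 𝕜).mkQ (lin 𝕜 f) := rfl

theorem mkQ_eq_zero {f : DPTerm →₀ 𝕜}
    (h : ∀ (V : Type u) [AddCommGroup V] [Module 𝕜 V] (P : DiffPoissonAlgebra 𝕜 V)
      (x : ℕ → V), evalPoly P x f = 0) : (identities 𝕜).mkQ f = 0 :=
  (Submodule.Quotient.mk_eq_zero _).2 h

/-- All identities are divided out at once, so each axiom of the free algebra is checked by
evaluating both sides in an arbitrary differential Poisson algebra. -/
theorem mkQ_eq {f g : DPTerm →₀ 𝕜}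
    (h : ∀ (V : Type u) [AddCommGroup V] [Module 𝕜 V] (P : DiffPoissonAlgebra 𝕜 V)
      (x : ℕ → V), evalPoly P x f = evalPoly P x g) :
    (identities 𝕜).mkQ f = (identities 𝕜).mkQ g :=
  (Submodule.Quotient.eq _).2 fun V _ _ P x => by rw [map_sub, h, sub_self]

variable (𝕜) in
/-- The free differential Poisson algebra on countably many generators. -/
noncomputable def algebra : DiffPoissonAlgebra 𝕜 (Carrier 𝕜) where
  mul := mul
  brk := brk
  d := d
  mul_assoc a b c := by
    obtain ⟨a, rfl⟩ := (identities 𝕜).mkQ_surjective a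
    obtain ⟨b, rfl⟩ := (identities 𝕜).mkQ_surjective b
    obtain ⟨c, rfl⟩ := (identities 𝕜).mkQ_surjective c
    simp only [mul_mkQ]
    exact mkQ_eq fun V _ _ P x => by simp only [eval_mul, P.mul_assoc]
  mul_comm a b := by
    obtain ⟨a, rfl⟩ := (identities 𝕜).mkQ_surjective a
    obtain ⟨b, rfl⟩ := (identities 𝕜).mkQ_surjective b
    simp only [mul_mkQ]
    exact mkQ_eq fun V _ _ P x => by simp only [eval_mul, P.mul_comm]
  brk_self a := by
    obtain ⟨a, rfl⟩ := (identities 𝕜).mkQ_surjective a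
    simp only [brk_mkQ]
    exact mkQ_eq_zero fun V _ _ P x => by simp only [eval_brk, P.brk_self]
  jacobi a b c := by
    obtain ⟨a, rfl⟩ := (identities 𝕜).mkQ_surjective a
    obtain ⟨b, rfl⟩ := (identities 𝕜).mkQ_surjective b
    obtain ⟨c, rfl⟩ := (identities 𝕜).mkQ_surjective c
    simp only [brk_mkQ, ← map_add]
    exact mkQ_eq_zero fun V _ _ P x => by simp only [eval_brk, map_add, P.jacobi]
  leibniz a b c := by
    obtain ⟨a, rfl⟩ := (identities 𝕜).mkQ_surjective a
    obtain ⟨b, rfl⟩ := (identities 𝕜).mkQ_surjective b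
    obtain ⟨c, rfl⟩ := (identities 𝕜).mkQ_surjective c
    simp only [brk_mkQ, mul_mkQ, ← map_add]
    exact mkQ_eq fun V _ _ P x => by simp only [eval_brk, eval_mul, map_add, P.leibniz]
  d_mul a b := by
    obtain ⟨a, rfl⟩ := (identities 𝕜).mkQ_surjective a
    obtain ⟨b, rfl⟩ := (identities 𝕜).mkQ_surjective b
    simp only [d_mkQ, mul_mkQ, ← map_add]
    exact mkQ_eq fun V _ _ P x => by simp only [eval_d, eval_mul, map_add, P.d_mul]
  d_brk a b := by
    obtain ⟨a, rfl⟩ := (identities 𝕜).mkQ_surjective a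
    obtain ⟨b, rfl⟩ := (identities 𝕜).mkQ_surjective b
    simp only [d_mkQ, brk_mkQ, ← map_add]
    exact mkQ_eq fun V _ _ P x => by simp only [eval_d, eval_brk, map_add, P.d_brk]

/-- The generators of the free differential Poisson algebra. -/
noncomputable def gen (i : ℕ) : Carrier 𝕜 := (identities 𝕜).mkQ (Finsupp.single (.var i) 1)

/-- The homomorphism from the free differential Poisson algebra determined by the images of the
generators. -/
noncomputable def lift {V : Type u} [AddCommGroup V] [Module 𝕜 V] (P : DiffPoissonAlgebra 𝕜 V)
    (x : ℕ → V) : Carrier 𝕜 →ₗ[𝕜] V :=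
  (identities 𝕜).liftQ (evalPoly P x) fun _ hf => hf V P x

theorem lift_gen {V : Type u} [AddCommGroup V] [Module 𝕜 V] (P : DiffPoissonAlgebra 𝕜 V)
    (x : ℕ → V) (i : ℕ) : lift P x (gen i) = x i := by
  simp [lift, gen, evalPoly, termValue]

theorem lift_mkQ {V : Type u} [AddCommGroup V] [Module 𝕜 V] (P : DiffPoissonAlgebra 𝕜 V)
    (x : ℕ → V) (f : DPTerm →₀ 𝕜) : lift P x ((identities 𝕜).mkQ f) = evalPoly P x f := rfl

theorem isHom_lift {V : Type u} [AddCommGroup V] [Module 𝕜 V] (P : DiffPoissonAlgebra 𝕜 V)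
    (x : ℕ → V) : (algebra 𝕜).IsHom P (lift P x) where
  map_mul a b := by
    obtain ⟨a, rfl⟩ := (identities 𝕜).mkQ_surjective a
    obtain ⟨b, rfl⟩ := (identities 𝕜).mkQ_surjective b
    simp only [algebra, mul_mkQ, lift_mkQ, eval_mul]
  map_brk a b := by
    obtain ⟨a, rfl⟩ := (identities 𝕜).mkQ_surjective a
    obtain ⟨b, rfl⟩ := (identities 𝕜).mkQ_surjective b
    simp only [algebra, brk_mkQ, lift_mkQ, eval_brk]
  map_d a := by
    obtain ⟨a, rfl⟩ := (identities 𝕜).mkQ_surjective a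
    simp only [algebra, d_mkQ, lift_mkQ, eval_d]

end FreeDP

/-! ### Identities of SGD tested on the free algebra -/

namespace GDPolynomial

open DiffPoissonAlgebra

variable {𝕜 : Type u} [Field 𝕜]

theorem map_evalMonomial {A B : Type u} [AddCommGroup A] [Module 𝕜 A] [AddCommGroup B]
    [Module 𝕜 B] {G : GDAlgebra 𝕜 A} {K : GDAlgebra 𝕜 B} {f : A →ₗ[𝕜] B} (hf : G.IsHom K f)
    (σ : ℕ → A) (t : GDMonomial) :
    f (GDMonomial.eval G σ t) = GDMonomial.eval K (fun i => f (σ i)) t := by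
  induction t with
  | var i => rfl
  | circ s t hs ht => simp only [GDMonomial.eval, hf.1, hs, ht]
  | brk s t hs ht => simp only [GDMonomial.eval, hf.2, hs, ht]

theorem map_eval {A B : Type u} [AddCommGroup A] [Module 𝕜 A] [AddCommGroup B]
    [Module 𝕜 B] {G : GDAlgebra 𝕜 A} {K : GDAlgebra 𝕜 B} {f : A →ₗ[𝕜] B} (hf : G.IsHom K f)
    (σ : ℕ → A) (p : GDPolynomial 𝕜) : f (eval G σ p) = eval K (fun i => f (σ i)) p := by
  have : f ∘ₗ (eval G σ) = eval K (fun i => f (σ i)) :=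
    Finsupp.lhom_ext fun t c => by
      change f (Finsupp.linearCombination 𝕜 _ (Finsupp.single t c)) =
        Finsupp.linearCombination 𝕜 _ (Finsupp.single t c)
      simp only [Finsupp.linearCombination_single, map_smul, map_evalMonomial hf]
  exact LinearMap.congr_fun this p

theorem isHom_toGD {V W : Type u} [AddCommGroup V] [Module 𝕜 V] [AddCommGroup W] [Module 𝕜 W]
    {P : DiffPoissonAlgebra 𝕜 V} {Q : DiffPoissonAlgebra 𝕜 W} {f : V →ₗ[𝕜] W}
    (hf : P.IsHom Q f) : P.toGD.IsHom Q.toGD f :=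
  ⟨fun a b => by simp only [toGD, LinearMap.compl₂_apply, hf.map_mul, hf.map_d],
    fun a b => hf.map_brk a b⟩

/-- A polynomial is an identity of the variety `SGD` if and only if it vanishes at the generators
of the free differential Poisson algebra. -/
theorem mem_idealSGD_iff (p : GDPolynomial 𝕜) :
    p ∈ idealSGD 𝕜 ↔ eval (FreeDP.algebra 𝕜).toGD FreeDP.gen p = 0 := by
  constructor
  · intro h
    refine h _ _ ⟨_, _, _, (FreeDP.algebra 𝕜).toGD, LinearMap.id, ⟨_, _, _, FreeDP.algebra 𝕜,
      LinearMap.id, ⟨fun _ _ => rfl, fun _ _ => rfl⟩, Function.injective_id⟩,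
      ⟨fun _ _ => rfl, fun _ _ => rfl⟩, Function.surjective_id⟩ _
  · intro h A _ _ G hG σ
    -- The substitution lifts to a special algebra, which embeds into some V; the value there is the
    -- image of the value at the free generators.
    obtain ⟨S, _, _, K, f, ⟨V, _, _, P, g, hg, hgi⟩, hf, hfs⟩ := hG
    choose τ hτ using fun i => hfs (σ i)
    have hσ : σ = fun i => f (τ i) := funext fun i => (hτ i).symm
    rw [hσ, ← map_eval hf]
    suffices eval K τ p = 0 by rw [this, map_zero]
    apply hgi
    rw [map_eval hg, map_zero]
    have := map_eval (isHom_toGD (FreeDP.isHom_lift P (fun i => g (τ i)))) FreeDP.gen p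
    rw [h, map_zero] at this
    simpa only [FreeDP.lift_gen] using this.symm

end GDPolynomial

/-! ### The generated GD-subalgebra is the part of weight -1 -/

namespace DiffPoissonAlgebra

variable {𝕜 V : Type u} [Field 𝕜] [AddCommGroup V] [Module 𝕜 V] (P : DiffPoissonAlgebra 𝕜 V)
  (x : ℕ → V)

theorem bilin_mem_of_mem_span {B : V →ₗ[𝕜] V →ₗ[𝕜] V} {s t : Set V} {p : Submodule 𝕜 V}
    (h : ∀ a ∈ s, ∀ b ∈ t, B a b ∈ p) {u v : V} (hu : u ∈ Submodule.span 𝕜 s)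
    (hv : v ∈ Submodule.span 𝕜 t) : B u v ∈ p := by
  have : Submodule.map₂ B (Submodule.span 𝕜 s) (Submodule.span 𝕜 t) ≤ p := by
    rw [Submodule.map₂_span_span, Submodule.span_le]
    rintro _ ⟨a, ha, b, hb, rfl⟩
    exact h a ha b hb
  exact this (Submodule.apply_mem_map₂ _ hu hv)

theorem lin_mem_of_mem_span {D : V →ₗ[𝕜] V} {s : Set V} {p : Submodule 𝕜 V}
    (h : ∀ a ∈ s, D a ∈ p) {u : V} (hu : u ∈ Submodule.span 𝕜 s) : D u ∈ p := by
  have : Submodule.span 𝕜 s ≤ p.comap D := Submodule.span_le.2 h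
  exact this hu

theorem mul_left_comm (a b c : V) : P.mul a (P.mul b c) = P.mul b (P.mul a c) := by
  rw [← P.mul_assoc, P.mul_comm a b, P.mul_assoc]

theorem leibniz_left (a b c : V) :
    P.brk (P.mul a b) c = P.mul a (P.brk b c) + P.mul (P.brk a c) b := by
  rw [P.brk_antisymm, P.leibniz, P.brk_antisymm c a, P.brk_antisymm c b]
  simp only [map_neg, LinearMap.neg_apply]
  abel

theorem brk_brk_left (a b c : V) :
    P.brk (P.brk a b) c = P.brk a (P.brk b c) - P.brk b (P.brk a c) := by
  have h := P.jacobi a b c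
  rw [P.brk_antisymm c (P.brk a b), P.brk_antisymm c a, map_neg] at h
  rw [← sub_eq_zero, ← neg_eq_zero, ← h]
  abel

/-- The span of the values of the Gelfand--Dorfman monomials with the given content. -/
def gdSpan (S : Multiset ℕ) : Submodule 𝕜 V :=
  Submodule.span 𝕜 (GDMonomial.eval P.toGD x '' {t | t.vars = S})

variable {P x}

theorem gen_mem_gdSpan (i : ℕ) : x i ∈ P.gdSpan x {i} :=
  Submodule.subset_span ⟨.var i, rfl, rfl⟩

theorem mul_d_mem_gdSpan {S R : Multiset ℕ} {u v : V} (hu : u ∈ P.gdSpan x S)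
    (hv : v ∈ P.gdSpan x R) : P.mul u (P.d v) ∈ P.gdSpan x (S + R) := by
  refine bilin_mem_of_mem_span (B := P.toGD.circ) ?_ hu hv
  rintro _ ⟨s, rfl, rfl⟩ _ ⟨t, rfl, rfl⟩
  exact Submodule.subset_span ⟨.circ s t, rfl, rfl⟩

theorem brk_mem_gdSpan {S R : Multiset ℕ} {u v : V} (hu : u ∈ P.gdSpan x S)
    (hv : v ∈ P.gdSpan x R) : P.brk u v ∈ P.gdSpan x (S + R) := by
  refine bilin_mem_of_mem_span (B := P.toGD.brk) ?_ hu hv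
  rintro _ ⟨s, rfl, rfl⟩ _ ⟨t, rfl, rfl⟩
  exact Submodule.subset_span ⟨.brk s t, rfl, rfl⟩

variable (P x) in
/-- The elements of content `S` which are carried to the Gelfand--Dorfman span by multiplication by
any `t` elements of that span. They have weight `t - 1`. -/
def transporter : ℕ → Multiset ℕ → Submodule 𝕜 V
  | 0, S => P.gdSpan x S
  | t + 1, S => ⨅ (R : Multiset ℕ) (h : P.gdSpan x R), (transporter t (R + S)).comap (P.mul h)

theorem mem_transporter_succ {t : ℕ} {S : Multiset ℕ} {u : V} :
    u ∈ P.transporter x (t + 1) S ↔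
      ∀ R, ∀ h ∈ P.gdSpan x R, P.mul h u ∈ P.transporter x t (R + S) := by
  simp [transporter]

/-- At index 0 this is h d(u) = h ∘ u. Above, k h d(u) = h d(ku) - (h d(k)) u: the first term has
lower index, and in the second h d(k) = h ∘ k is again a GD-element. -/
theorem d_mem_transporter {t : ℕ} : ∀ {S : Multiset ℕ} {u : V}, u ∈ P.transporter x t S →
    P.d u ∈ P.transporter x (t + 1) S := by
  induction t with
  | zero =>
    intro S u hu
    exact mem_transporter_succ.2 fun R h hh => mul_d_mem_gdSpan hh hu
  | succ t ih =>
    intro S u hu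
    refine mem_transporter_succ.2 fun R h hh => mem_transporter_succ.2 fun Q k hk => ?_
    have h1 := mem_transporter_succ.1 (ih (mem_transporter_succ.1 hu Q k hk)) R h hh
    have h2 := mem_transporter_succ.1 hu _ _ (mul_d_mem_gdSpan hh hk)
    have e : P.mul k (P.mul h (P.d u)) =
        P.mul h (P.d (P.mul k u)) - P.mul (P.mul h (P.d k)) u := by
      rw [P.d_mul, map_add, P.mul_assoc, P.mul_left_comm k h]
      abel
    rw [e, add_left_comm]
    rw [add_assoc] at h2
    exact sub_mem h1 h2

/-- Weights add, s + (t-1) = (s+t) - 1. One factor must have positive index, since two factors of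
weight -1 would give weight -2, below the range of the transporters. -/
theorem mul_mem_transporter {s t : ℕ} : ∀ {S R : Multiset ℕ} {u v : V},
    u ∈ P.transporter x (s + 1) S → v ∈ P.transporter x t R →
    P.mul u v ∈ P.transporter x (s + t) (S + R) := by
  induction t with
  | zero =>
    intro S R u v hu hv
    rw [P.mul_comm, add_comm S R]
    exact mem_transporter_succ.1 hu R v hv
  | succ t ih =>
    intro S R u v hu hv
    refine mem_transporter_succ.2 fun Q h hh => ?_
    rw [P.mul_left_comm, add_left_comm]
    exact ih hu (mem_transporter_succ.1 hv Q h hh)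

/-- The multiplier k moves inside the bracket by Leibniz; the error term involves {h,k}, which is
again a GD-element. -/
theorem brk_gdSpan_mem_transporter {t : ℕ} : ∀ {S R : Multiset ℕ} {h v : V},
    h ∈ P.gdSpan x S → v ∈ P.transporter x t R → P.brk h v ∈ P.transporter x t (S + R) := by
  induction t with
  | zero =>
    intro S R h v hh hv
    exact brk_mem_gdSpan hh hv
  | succ t ih =>
    intro S R h v hh hv
    refine mem_transporter_succ.2 fun Q k hk => ?_
    have e : P.mul k (P.brk h v) = P.brk h (P.mul k v) - P.mul (P.brk h k) v := by
      rw [P.leibniz]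
      abel
    have h2 := mem_transporter_succ.1 hv _ _ (brk_mem_gdSpan hh hk)
    rw [e, add_left_comm]
    rw [add_assoc] at h2
    exact sub_mem (ih hh (mem_transporter_succ.1 hv Q k hk)) h2

/-- Induction lowers the index of u: h{u,v} = {hu,v} - u{h,v}, where the last product falls under
`mul_mem_transporter`. -/
theorem brk_mem_transporter {s t : ℕ} : ∀ {S R : Multiset ℕ} {u v : V},
    u ∈ P.transporter x s S → v ∈ P.transporter x t R →
    P.brk u v ∈ P.transporter x (s + t) (S + R) := by
  induction s with
  | zero =>
    intro S R u v hu hv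
    rw [zero_add]
    exact brk_gdSpan_mem_transporter hu hv
  | succ s ih =>
    intro S R u v hu hv
    rw [Nat.succ_add_eq_add_succ]
    refine mem_transporter_succ.2 fun Q h hh => ?_
    have e : P.mul h (P.brk u v) = P.brk (P.mul h u) v - P.mul u (P.brk h v) := by
      rw [P.leibniz_left, P.mul_comm u]
      abel
    have h2 := mul_mem_transporter hu (brk_gdSpan_mem_transporter hh hv)
    rw [e, ← add_assoc]
    rw [add_left_comm, ← add_assoc] at h2
    exact sub_mem (ih (mem_transporter_succ.1 hu Q h hh) hv) h2

variable (P x) in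
/-- The span of the products of `r + 1` elements of the Gelfand--Dorfman span. They have weight
`-r - 1`. -/
def gdPower : ℕ → Multiset ℕ → Submodule 𝕜 V
  | 0, S => P.gdSpan x S
  | r + 1, S => Submodule.span 𝕜 {v | ∃ R Q, S = R + Q ∧ ∃ g ∈ P.gdSpan x R,
      ∃ w ∈ gdPower r Q, v = P.mul g w}

/-- Each GD-factor of v lowers the index of u by one until index 0 is reached; the remaining factors
form a power. The hypothesis is the weight balance (t-1) - (r+1) = -(k+1). -/
theorem mul_mem_gdPower {r t : ℕ} : ∀ {k : ℕ} {S R : Multiset ℕ} {u v : V}, t + k = r + 1 →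
    u ∈ P.transporter x t S → v ∈ P.gdPower x r R → P.mul u v ∈ P.gdPower x k (S + R) := by
  induction r generalizing t with
  | zero =>
    intro k S R u v hk hu hv
    obtain ⟨rfl, rfl⟩ | ⟨rfl, rfl⟩ : t = 0 ∧ k = 1 ∨ t = 1 ∧ k = 0 := by omega
    · exact Submodule.subset_span ⟨S, R, rfl, u, hu, v, hv, rfl⟩
    · exact mul_mem_transporter hu (t := 0) hv
  | succ r ih =>
    intro k S R u v hk hu hv
    match t, hk with
    | 0, hk =>
      obtain rfl : k = r + 1 + 1 := by omega
      exact Submodule.subset_span ⟨S, R, rfl, u, hu, v, hv, rfl⟩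
    | t + 1, hk =>
      refine lin_mem_of_mem_span (D := P.mul u) ?_ hv
      rintro _ ⟨R, Q, rfl, g, hg, w, hw, rfl⟩
      rw [← P.mul_assoc, ← add_assoc]
      exact ih (by omega) (mul_mem_transporter hu (t := 0) hg) hw

/-- The complementary case: u has enough index to absorb all r+1 factors, and (t-1) - (r+1) = k-1.
-/
theorem mul_mem_transporter_of_gdPower {r t : ℕ} : ∀ {k : ℕ} {S R : Multiset ℕ} {u v : V},
    t = k + r + 1 → u ∈ P.transporter x t S → v ∈ P.gdPower x r R →
    P.mul u v ∈ P.transporter x k (S + R) := by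
  induction r generalizing t with
  | zero =>
    rintro k S R u v rfl hu hv
    exact mul_mem_transporter hu (t := 0) hv
  | succ r ih =>
    rintro k S R u v rfl hu hv
    refine lin_mem_of_mem_span (D := P.mul u) ?_ hv
    rintro _ ⟨R, Q, rfl, g, hg, w, hw, rfl⟩
    rw [← P.mul_assoc, ← add_assoc]
    exact ih (by omega) (mul_mem_transporter (s := k + (r + 1)) hu (t := 0) hg) hw

variable (P x) in
/-- The letter `(i, j)` stands for the `j`-th derivative of the `i`-th generator. -/
def letter (c : ℕ × ℕ) : V := (P.d ^ c.2) (x c.1)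

variable (P x) in
/-- `IsLie P x S t u` says that `u` is a Lie monomial in derivatives of generators with content `S`
and `t` derivations in total. -/
inductive IsLie : Multiset ℕ → ℕ → V → Prop
  | letter (c : ℕ × ℕ) : IsLie {c.1} c.2 (P.letter x c)
  | brk {S R s t u v} : IsLie S s u → IsLie R t v → IsLie (S + R) (s + t) (P.brk u v)

variable (P x) in
/-- `IsProd P x S t m u` says that `u` is a product of `m + 1` Lie monomials in derivatives of
generators with content `S` and `t` derivations in total. -/
inductive IsProd : Multiset ℕ → ℕ → ℕ → V → Prop
  | lie {S t u} : IsLie P x S t u → IsProd S t 0 u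
  | mul {S R s t m u v} : IsLie P x S s u → IsProd R t m v →
      IsProd (S + R) (s + t) (m + 1) (P.mul u v)

theorem letter_zero (i : ℕ) : P.letter x (i, 0) = x i := rfl

theorem letter_succ (i j : ℕ) : P.letter x (i, j + 1) = P.d (P.letter x (i, j)) := by
  simp only [letter, pow_succ', Module.End.mul_apply]

theorem IsLie.mem_transporter {S : Multiset ℕ} {t : ℕ} {u : V} (h : IsLie P x S t u) :
    u ∈ P.transporter x t S := by
  induction h with
  | letter c =>
    obtain ⟨i, j⟩ := c
    induction j with
    | zero => exact letter_zero (P := P) (x := x) i ▸ gen_mem_gdSpan i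
    | succ j ih => exact letter_succ (P := P) (x := x) i j ▸ d_mem_transporter ih
  | brk _ _ hu hv => exact brk_mem_transporter hu hv

/-- The weight t-m-1 is either k-1 or -(k+1). Both ranges must be carried through the induction
because the tail of a product of weight -1 may have any weight; the two meet at k = 0. -/
theorem IsProd.mem {S : Multiset ℕ} {t m : ℕ} {u : V} (h : IsProd P x S t m u) :
    (∀ k, t = m + k → u ∈ P.transporter x k S) ∧ (∀ k, m = t + k → u ∈ P.gdPower x k S) := by
  induction h with
  | @lie S t u h =>
    refine ⟨fun k hk => ?_, fun k hk => ?_⟩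
    · obtain rfl : t = k := by simpa using hk
      exact h.mem_transporter
    · obtain ⟨rfl, rfl⟩ : t = 0 ∧ k = 0 := by omega
      exact h.mem_transporter
  | @mul S R s t m u v hu hv ih =>
    refine ⟨fun k hk => ?_, fun k hk => ?_⟩
    · rcases le_total m t with hmt | hmt
      · obtain ⟨l, rfl⟩ := Nat.exists_eq_add_of_le hmt
        -- If s = 0 then u is itself a GD-element and the tail v absorbs it; otherwise u has the
        -- positive index required of the first factor.
        rcases Nat.eq_zero_or_pos s with rfl | hs
        · obtain rfl : l = k + 1 := by omega
          rw [P.mul_comm, add_comm]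
          exact mul_mem_transporter (ih.1 _ rfl) (t := 0) hu.mem_transporter
        · obtain ⟨s, rfl⟩ := Nat.exists_eq_add_of_le' hs
          obtain rfl : k = s + l := by omega
          exact mul_mem_transporter hu.mem_transporter (ih.1 _ rfl)
      · obtain ⟨l, rfl⟩ := Nat.exists_eq_add_of_le hmt
        exact mul_mem_transporter_of_gdPower (by omega) hu.mem_transporter (ih.2 _ rfl)
    · rcases le_total m t with hmt | hmt
      · obtain ⟨l, rfl⟩ := Nat.exists_eq_add_of_le hmt
        obtain ⟨rfl, rfl, rfl⟩ | ⟨rfl, rfl, rfl⟩ | ⟨rfl, rfl, rfl⟩ :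
          s = 0 ∧ l = 0 ∧ k = 1 ∨ s = 1 ∧ l = 0 ∧ k = 0 ∨ s = 0 ∧ l = 1 ∧ k = 0 := by omega
        · exact Submodule.subset_span ⟨S, R, rfl, u, hu.mem_transporter, v, ih.1 _ rfl, rfl⟩
        · exact mul_mem_transporter hu.mem_transporter (ih.1 _ rfl)
        · rw [P.mul_comm, add_comm]
          exact mul_mem_transporter (ih.1 _ rfl) (t := 0) hu.mem_transporter
      · obtain ⟨l, rfl⟩ := Nat.exists_eq_add_of_le hmt
        exact mul_mem_gdPower (by omega) hu.mem_transporter (ih.2 _ rfl)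

variable (P x) in
/-- The span of the products of Lie monomials. -/
def prodSpan (S : Multiset ℕ) (t m : ℕ) : Submodule 𝕜 V :=
  Submodule.span 𝕜 {u | IsProd P x S t m u}

variable (P x) in
/-- The span of the products of Lie monomials of weight `-1`. -/
def weightSpan (S : Multiset ℕ) : Submodule 𝕜 V :=
  Submodule.span 𝕜 {u | ∃ m, IsProd P x S m m u}

theorem prodSpan_le_weightSpan (S : Multiset ℕ) (m : ℕ) :
    P.prodSpan x S m m ≤ P.weightSpan x S :=
  Submodule.span_mono fun _ h => ⟨m, h⟩

theorem weightSpan_le_gdSpan (S : Multiset ℕ) : P.weightSpan x S ≤ P.gdSpan x S :=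
  Submodule.span_le.2 fun _ ⟨_, h⟩ => h.mem.1 0 rfl

theorem IsProd.mul_isProd {S R : Multiset ℕ} {s t m l : ℕ} {u v : V} (hu : IsProd P x S s m u)
    (hv : IsProd P x R t l v) : IsProd P x (S + R) (s + t) (m + l + 1) (P.mul u v) := by
  induction hu with
  | lie h =>
    rw [zero_add]
    exact .mul h hv
  | mul h _ ih =>
    rw [P.mul_assoc, add_assoc, add_assoc, add_right_comm _ 1 l]
    exact .mul h ih

theorem IsLie.d_mem {S : Multiset ℕ} {t : ℕ} {u : V} (h : IsLie P x S t u) :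
    P.d u ∈ Submodule.span 𝕜 {u | IsLie P x S (t + 1) u} := by
  induction h with
  | letter c =>
    obtain ⟨i, j⟩ := c
    rw [← letter_succ]
    exact Submodule.subset_span (.letter (i, j + 1))
  | @brk S R s t u v hu hv ihu ihv =>
    rw [P.d_brk]
    refine add_mem ?_ ?_
    · refine lin_mem_of_mem_span (D := P.brk.flip v) (fun a ha => ?_) ihu
      rw [add_right_comm]
      exact Submodule.subset_span (.brk ha hv)
    · refine lin_mem_of_mem_span (D := P.brk u) (fun a ha => ?_) ihv
      rw [add_assoc]
      exact Submodule.subset_span (.brk hu ha)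

theorem IsProd.d_mem {S : Multiset ℕ} {t m : ℕ} {u : V} (h : IsProd P x S t m u) :
    P.d u ∈ P.prodSpan x S (t + 1) m := by
  induction h with
  | lie h => exact Submodule.span_mono (fun _ hu => .lie hu) h.d_mem
  | @mul S R s t m u v hu hv ih =>
    rw [P.d_mul]
    refine add_mem ?_ ?_
    · refine lin_mem_of_mem_span (D := P.mul.flip v) (fun a ha => ?_) hu.d_mem
      rw [add_right_comm]
      exact Submodule.subset_span (.mul ha hv)
    · refine lin_mem_of_mem_span (D := P.mul u) (fun a ha => ?_) ih
      rw [add_assoc]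
      exact Submodule.subset_span (.mul hu ha)

theorem IsLie.brk_isProd_mem {S R : Multiset ℕ} {s t m : ℕ} {u v : V} (hu : IsLie P x S s u)
    (hv : IsProd P x R t m v) : P.brk u v ∈ P.prodSpan x (S + R) (s + t) m := by
  induction hv with
  | lie h => exact Submodule.subset_span (.lie (.brk hu h))
  | @mul R Q t r m v w hv hw ih =>
    rw [P.leibniz]
    refine add_mem ?_ ?_
    · rw [← add_assoc, ← add_assoc]
      exact Submodule.subset_span (.mul (.brk hu hv) hw)
    · refine lin_mem_of_mem_span (D := P.mul v) (fun a ha => ?_) ih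
      rw [add_left_comm, add_left_comm s]
      exact Submodule.subset_span (.mul hv ha)

theorem IsProd.brk_mem {S R : Multiset ℕ} {s t m l : ℕ} {u v : V} (hu : IsProd P x S s m u)
    (hv : IsProd P x R t l v) : P.brk u v ∈ P.prodSpan x (S + R) (s + t) (m + l) := by
  induction hu with
  | lie h =>
    rw [zero_add]
    exact h.brk_isProd_mem hv
  | @mul S Q s r m u w hu hw ih =>
    rw [P.leibniz_left]
    refine add_mem ?_ ?_
    · refine lin_mem_of_mem_span (D := P.mul u) (fun a ha => ?_) ih
      rw [add_assoc, add_assoc, add_right_comm]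
      exact Submodule.subset_span (.mul hu ha)
    · refine lin_mem_of_mem_span (D := P.mul.flip w) (fun a ha => ?_) (hu.brk_isProd_mem hv)
      rw [add_right_comm, add_right_comm s, add_right_comm m, add_comm m]
      exact Submodule.subset_span (IsProd.mul_isProd ha hw)

theorem gdSpan_le_weightSpan (S : Multiset ℕ) : P.gdSpan x S ≤ P.weightSpan x S := by
  refine Submodule.span_le.2 ?_
  rintro _ ⟨t, rfl, rfl⟩
  change GDMonomial.eval P.toGD x t ∈ P.weightSpan x t.vars
  induction t with
  | var i => exact Submodule.subset_span ⟨0, .lie (.letter (i, 0))⟩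
  | circ s t hs ht =>
    refine bilin_mem_of_mem_span (B := P.toGD.circ) ?_ hs ht
    rintro a ⟨m, ha⟩ b ⟨l, hb⟩
    refine lin_mem_of_mem_span (D := P.mul a) (fun c hc => ?_) hb.d_mem
    exact Submodule.subset_span ⟨m + l + 1, ha.mul_isProd hc⟩
  | brk s t hs ht =>
    refine bilin_mem_of_mem_span (B := P.toGD.brk) ?_ hs ht
    rintro a ⟨m, ha⟩ b ⟨l, hb⟩
    exact prodSpan_le_weightSpan _ _ (ha.brk_mem hb)

/-- The Gelfand--Dorfman subalgebra generated by the generators consists of the elements of weight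
`-1`. -/
theorem gdSpan_eq_weightSpan (S : Multiset ℕ) : P.gdSpan x S = P.weightSpan x S :=
  le_antisymm (gdSpan_le_weightSpan S) (weightSpan_le_gdSpan S)

end DiffPoissonAlgebra

/-! ### Words and their blocks -/

/-- The decomposition of a word in the letters `(i, j)` into blocks that end at the right-to-left
minima (with respect to the first index). -/
def wordBlocks : List (ℕ × ℕ) → List (List (ℕ × ℕ))
  | [] => []
  | c :: w =>
    if ∀ y ∈ w, c.1 < y.1 then [c] :: wordBlocks w
    else match wordBlocks w with
      | [] => [[c]]
      | b :: l => (c :: b) :: l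

theorem wordBlocks_cons_of_lt {c : ℕ × ℕ} {w : List (ℕ × ℕ)} (h : ∀ y ∈ w, c.1 < y.1) :
    wordBlocks (c :: w) = [c] :: wordBlocks w := by
  rw [wordBlocks, if_pos h]

theorem wordBlocks_ne_nil {w : List (ℕ × ℕ)} (h : w ≠ []) : wordBlocks w ≠ [] := by
  cases w with
  | nil => exact absurd rfl h
  | cons c w =>
    rw [wordBlocks]
    split_ifs
    · simp
    · split <;> simp

theorem wordBlocks_cons_of_not_lt {c : ℕ × ℕ} {w : List (ℕ × ℕ)} (h : ¬ ∀ y ∈ w, c.1 < y.1) :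
    ∃ b l, wordBlocks w = b :: l ∧ wordBlocks (c :: w) = (c :: b) :: l := by
  have hw : w ≠ [] := by
    rintro rfl
    simp at h
  obtain ⟨b, l, hbl⟩ := List.exists_cons_of_ne_nil (wordBlocks_ne_nil hw)
  exact ⟨b, l, hbl, by rw [wordBlocks, if_neg h, hbl]⟩

/-- No letter before a is a right-to-left minimum, since a lies to its right and is smaller; hence
the first block closes exactly at a. -/
theorem wordBlocks_append {a : ℕ × ℕ} {w w' : List (ℕ × ℕ)} (hw : ∀ y ∈ w, a.1 < y.1)
    (hw' : ∀ y ∈ w', a.1 < y.1) :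
    wordBlocks (w ++ [a] ++ w') = (w ++ [a]) :: wordBlocks w' := by
  induction w with
  | nil => exact wordBlocks_cons_of_lt hw'
  | cons c w ih =>
    have hc : ¬ ∀ y ∈ w ++ [a] ++ w', c.1 < y.1 := fun h =>
      lt_asymm (h a (by simp)) (hw c (by simp))
    obtain ⟨b, l, h1, h2⟩ := wordBlocks_cons_of_not_lt hc
    rw [ih fun y hy => hw y (List.mem_cons_of_mem _ hy)] at h1
    obtain ⟨rfl, rfl⟩ := List.cons.inj h1
    exact h2

theorem flatten_wordBlocks (w : List (ℕ × ℕ)) : (wordBlocks w).flatten = w := by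
  induction w with
  | nil => rfl
  | cons c w ih =>
    by_cases h : ∀ y ∈ w, c.1 < y.1
    · rw [wordBlocks_cons_of_lt h, List.flatten_cons, ih]
      rfl
    · obtain ⟨b, l, h1, h2⟩ := wordBlocks_cons_of_not_lt h
      rw [h1, List.flatten_cons] at ih
      rw [h2, List.flatten_cons, List.cons_append, ih]

/-- The last letter of the word is smaller than all other letters. -/
def EndsWithMin (b : List (ℕ × ℕ)) : Prop := ∃ v a, b = v ++ [a] ∧ ∀ y ∈ v, a.1 < y.1

theorem mem_of_mem_wordBlocks {w b : List (ℕ × ℕ)} {y : ℕ × ℕ} (hb : b ∈ wordBlocks w)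
    (hy : y ∈ b) : y ∈ w := by
  rw [← flatten_wordBlocks w]
  exact List.mem_flatten.2 ⟨b, hb, hy⟩

/-- The second claim orders the blocks strictly, so that their multiset determines their order. -/
theorem wordBlocks_spec {w : List (ℕ × ℕ)} (hw : (w.map Prod.fst).Nodup) :
    (∀ b ∈ wordBlocks w, EndsWithMin b) ∧
      (wordBlocks w).Pairwise (fun b b' => ∃ c ∈ b, ∀ y ∈ b', c.1 < y.1) := by
  induction w with
  | nil => simp [wordBlocks]
  | cons c w ih =>
    rw [List.map_cons, List.nodup_cons] at hw
    obtain ⟨ih₁, ih₂⟩ := ih hw.2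
    by_cases h : ∀ y ∈ w, c.1 < y.1
    · rw [wordBlocks_cons_of_lt h]
      refine ⟨List.forall_mem_cons.2 ⟨⟨[], c, rfl, by simp⟩, ih₁⟩, List.pairwise_cons.2
        ⟨fun b hb => ⟨c, List.mem_singleton_self c, fun y hy => ?_⟩, ih₂⟩⟩
      exact h y (mem_of_mem_wordBlocks hb hy)
    · obtain ⟨b, l, h₁, h₂⟩ := wordBlocks_cons_of_not_lt h
      have hf := flatten_wordBlocks w
      rw [h₁] at ih₁ ih₂ hf
      rw [h₂]
      obtain ⟨⟨v, a, rfl, hv⟩, ih₄⟩ := List.forall_mem_cons.1 ih₁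
      obtain ⟨ih₂, ih₃⟩ := List.pairwise_cons.1 ih₂
      have hle : ∀ y ∈ v ++ [a], a.1 ≤ y.1 := fun y hy => by
        rcases List.mem_append.1 hy with hy | hy
        · exact (hv y hy).le
        · rw [List.mem_singleton.1 hy]
      have hle' : ∀ y ∈ w, a.1 ≤ y.1 := fun y hy => by
        rw [← hf, List.flatten_cons, List.mem_append] at hy
        rcases hy with hy | hy
        · exact hle y hy
        · obtain ⟨b', hb', hy⟩ := List.mem_flatten.1 hy
          obtain ⟨e, he, hlt⟩ := ih₂ b' hb'
          exact (hle e he).trans (hlt y hy).le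
      -- Here c is not below every later letter, a is least among them, and equality would repeat an
      -- index.
      have hac : a.1 < c.1 := by
        push Not at h
        obtain ⟨y, hy, hyc⟩ := h
        refine lt_of_le_of_ne ((hle' y hy).trans hyc) fun hne => hw.1 ?_
        have : y.1 = c.1 := le_antisymm hyc (hne ▸ hle' y hy)
        exact this ▸ List.mem_map_of_mem hy
      refine ⟨List.forall_mem_cons.2 ⟨⟨c :: v, a, rfl, List.forall_mem_cons.2 ⟨hac, hv⟩⟩, ih₄⟩,
        List.pairwise_cons.2 ⟨fun b' hb' => ?_, ih₃⟩⟩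
      obtain ⟨e, he, hlt⟩ := ih₂ b' hb'
      exact ⟨e, List.mem_cons_of_mem c he, hlt⟩

theorem eq_of_wordBlocks_perm {w w' : List (ℕ × ℕ)} (hw : (w.map Prod.fst).Nodup)
    (hw' : (w'.map Prod.fst).Nodup) (h : (wordBlocks w).Perm (wordBlocks w')) : w = w' := by
  rw [← flatten_wordBlocks w, ← flatten_wordBlocks w']
  congr 1
  refine h.eq_of_pairwise ?_ (wordBlocks_spec hw).2 (wordBlocks_spec hw').2
  rintro b b' - - ⟨c, hc, hlt⟩ ⟨c', hc', hlt'⟩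
  exact absurd (hlt c' hc') (lt_asymm (hlt' c hc))

/-! ### Normal monomials span the multilinear part -/

namespace DiffPoissonAlgebra

variable {𝕜 V : Type u} [Field 𝕜] [AddCommGroup V] [Module 𝕜 V] (P : DiffPoissonAlgebra 𝕜 V)
  (x : ℕ → V)

/-- The right-normed Lie monomial spelled by a word. -/
def rightNormed : List (ℕ × ℕ) → V
  | [] => 0
  | [c] => P.letter x c
  | c :: c' :: w => P.brk (P.letter x c) (rightNormed (c' :: w))

/-- The product of a nonempty list of elements. -/
def listProd : List V → V
  | [] => 0
  | [a] => a
  | a :: b :: l => P.mul a (listProd (b :: l))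

/-- The normal monomial spelled by a word: the product of the right-normed Lie monomials of its
blocks. -/
def normalMonomial (w : List (ℕ × ℕ)) : V := P.listProd ((wordBlocks w).map (P.rightNormed x))

variable {P x}

theorem rightNormed_cons {c : ℕ × ℕ} {w : List (ℕ × ℕ)} (h : w ≠ []) :
    P.rightNormed x (c :: w) = P.brk (P.letter x c) (P.rightNormed x w) := by
  obtain ⟨b, l, rfl⟩ := List.exists_cons_of_ne_nil h
  rfl

theorem listProd_cons {a : V} {l : List V} (h : l ≠ []) :
    P.listProd (a :: l) = P.mul a (P.listProd l) := by
  obtain ⟨b, l, rfl⟩ := List.exists_cons_of_ne_nil h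
  rfl

variable (P x) in
/-- The span of the right-normed Lie monomials with given content, number of derivations and
innermost generator. -/
def rightNormedSpan (a : ℕ) (S : Multiset ℕ) (t : ℕ) : Submodule 𝕜 V :=
  Submodule.span 𝕜 {v | ∃ w j, ((w.map Prod.fst : List ℕ) : Multiset ℕ) + {a} = S ∧
    (w.map Prod.snd).sum + j = t ∧ v = P.rightNormed x (w ++ [(a, j)])}

/-- By Jacobi, ad{u,v} is the commutator of ad u and ad v, so bracketing with a Lie monomial reduces
to bracketing with single letters, which prepends them. -/
theorem IsLie.brk_mem_rightNormedSpan {a : ℕ} {R : Multiset ℕ} {s : ℕ} {u : V}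
    (hu : IsLie P x R s u) : ∀ {S : Multiset ℕ} {t : ℕ} {v : V},
    v ∈ P.rightNormedSpan x a S t → P.brk u v ∈ P.rightNormedSpan x a (R + S) (s + t) := by
  induction hu with
  | letter c =>
    intro S t v hv
    refine lin_mem_of_mem_span (D := P.brk (P.letter x c)) ?_ hv
    rintro _ ⟨w, j, rfl, rfl, rfl⟩
    refine Submodule.subset_span ⟨c :: w, j, ?_, ?_, ?_⟩
    · rw [List.map_cons, ← Multiset.cons_coe, ← Multiset.singleton_add, add_assoc]
    · simp [add_assoc]
    · exact (rightNormed_cons (by simp)).symm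
  | brk _ _ ihu ihv =>
    intro Q t w hw
    rw [P.brk_brk_left]
    refine sub_mem ?_ ?_
    · rw [add_assoc, add_assoc]
      exact ihu (ihv hw)
    · rw [add_assoc, add_assoc, add_left_comm, add_left_comm (a := (_ : ℕ))]
      exact ihv (ihu hw)

/-- Antisymmetry puts the factor containing a on the right; the other factor then acts by the
previous lemma. -/
theorem IsLie.mem_rightNormedSpan {a : ℕ} {S : Multiset ℕ} {t : ℕ} {u : V}
    (hu : IsLie P x S t u) (ha : a ∈ S) : u ∈ P.rightNormedSpan x a S t := by
  induction hu with
  | letter c =>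
    obtain rfl := Multiset.mem_singleton.1 ha
    exact Submodule.subset_span ⟨[], c.2, by simp, by simp, rfl⟩
  | brk hu hv ihu ihv =>
    rcases Multiset.mem_add.1 ha with ha | ha
    · rw [P.brk_antisymm, add_comm, add_comm (a := (_ : ℕ))]
      exact neg_mem (hv.brk_mem_rightNormedSpan (ihu ha))
    · exact hu.brk_mem_rightNormedSpan (ihv ha)

theorem IsProd.exists_factor {a : ℕ} {S : Multiset ℕ} {t m : ℕ} {u : V}
    (hu : IsProd P x S t m u) (ha : a ∈ S) : (m = 0 ∧ IsLie P x S t u) ∨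
      ∃ S₁ S₂ t₁ t₂ l u₁ u₂, a ∈ S₁ ∧ S = S₁ + S₂ ∧ t = t₁ + t₂ ∧ m = l + 1 ∧
        u = P.mul u₁ u₂ ∧ IsLie P x S₁ t₁ u₁ ∧ IsProd P x S₂ t₂ l u₂ := by
  induction hu with
  | lie h => exact .inl ⟨rfl, h⟩
  | @mul S R s t m u v hu hv ih =>
    right
    rcases Multiset.mem_add.1 ha with ha | ha
    · exact ⟨S, R, s, t, m, u, v, ha, rfl, rfl, rfl, rfl, hu, hv⟩
    · rcases ih ha with ⟨rfl, h⟩ | ⟨S₁, S₂, t₁, t₂, l, u₁, u₂, ha₁, rfl, rfl, rfl, rfl, h₁, h₂⟩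
      · exact ⟨R, S, t, s, 0, v, u, ha, add_comm _ _, add_comm _ _, rfl, P.mul_comm _ _, h,
          .lie hu⟩
      · exact ⟨S₁, S + S₂, t₁, s + t₂, l + 1, u₁, P.mul u u₂, ha₁, add_left_comm _ _ _,
          add_left_comm _ _ _, rfl, P.mul_left_comm _ _ _, h₁, .mul hu h₂⟩

variable (P x) in
/-- The span of the normal monomials with given content, number of derivations and number of
blocks. -/
def normalSpan (S : Multiset ℕ) (t m : ℕ) : Submodule 𝕜 V :=
  Submodule.span 𝕜 {v | ∃ w, ((w.map Prod.fst : List ℕ) : Multiset ℕ) = S ∧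
    (w.map Prod.snd).sum = t ∧ (wordBlocks w).length = m + 1 ∧ P.normalMonomial x w = v}

theorem IsLie.content_ne_zero {S : Multiset ℕ} {t : ℕ} {u : V} (h : IsLie P x S t u) : S ≠ 0 := by
  induction h with
  | letter c => simp
  | brk _ _ h _ => exact fun h0 => h (add_eq_zero.1 h0).1

theorem IsProd.content_ne_zero {S : Multiset ℕ} {t m : ℕ} {u : V} (h : IsProd P x S t m u) :
    S ≠ 0 := by
  cases h with
  | lie h => exact h.content_ne_zero
  | mul h _ => exact fun h0 => h.content_ne_zero (add_eq_zero.1 h0).1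

theorem forall_lt_of_min {a : ℕ} {w : List (ℕ × ℕ)}
    (hmin : ∀ i ∈ ((w.map Prod.fst : List ℕ) : Multiset ℕ) + {a}, a ≤ i)
    (hS : (((w.map Prod.fst : List ℕ) : Multiset ℕ) + {a}).Nodup) : ∀ y ∈ w, a < y.1 := by
  intro y hy
  have hy' : y.1 ∈ ((w.map Prod.fst : List ℕ) : Multiset ℕ) :=
    Multiset.mem_coe.2 (List.mem_map_of_mem hy)
  refine lt_of_le_of_ne (hmin _ (Multiset.mem_add.2 (.inl hy'))) ?_
  rintro rfl
  exact Multiset.disjoint_left.1 (Multiset.nodup_add.1 hS).2.2 hy' (Multiset.mem_singleton_self _)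

/-- Take the least generator a of the content, bring its Lie factor to the front, and make it
right-normed with a innermost. As a is least in the whole product, `wordBlocks_append` makes this
factor the first block, and induction treats the rest. -/
theorem IsProd.mem_normalSpan {m : ℕ} : ∀ {S : Multiset ℕ} {t : ℕ} {u : V},
    IsProd P x S t m u → S.Nodup → u ∈ P.normalSpan x S t m := by
  induction m with
  | zero =>
    intro S t u hu hS
    obtain ⟨a, ha, hmin⟩ := S.toFinset.exists_min_image id
      (by simpa [Finset.nonempty_iff_ne_empty] using hu.content_ne_zero)
    simp only [Multiset.mem_toFinset, id] at ha hmin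
    rcases hu.exists_factor ha with ⟨-, h⟩ | ⟨_, _, _, _, _, _, _, _, _, _, h, _⟩
    · refine Submodule.span_mono ?_ (h.mem_rightNormedSpan ha)
      rintro _ ⟨w, j, rfl, rfl, rfl⟩
      have hw : ∀ y ∈ w, a < y.1 := forall_lt_of_min hmin hS
      have hb := wordBlocks_append (a := (a, j)) (w := w) (w' := []) hw (by simp)
      rw [List.append_nil] at hb
      refine ⟨w ++ [(a, j)], by simp [← Multiset.coe_add], by simp, by simp [hb, wordBlocks], ?_⟩
      simp [normalMonomial, hb, wordBlocks, listProd]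
    · omega
  | succ m ih =>
    intro S t u hu hS
    obtain ⟨a, ha, hmin⟩ := S.toFinset.exists_min_image id
      (by simpa [Finset.nonempty_iff_ne_empty] using hu.content_ne_zero)
    simp only [Multiset.mem_toFinset, id] at ha hmin
    rcases hu.exists_factor ha with ⟨h, -⟩ |
      ⟨S₁, S₂, t₁, t₂, l, u₁, u₂, ha₁, rfl, rfl, hl, rfl, h₁, h₂⟩
    · omega
    obtain rfl : m = l := by omega
    refine bilin_mem_of_mem_span (B := P.mul) ?_ (h₁.mem_rightNormedSpan ha₁)
      (ih h₂ (Multiset.nodup_add.1 hS).2.1)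
    rintro _ ⟨w, j, rfl, rfl, rfl⟩ _ ⟨w', rfl, rfl, hlen, rfl⟩
    have hS' := hS
    rw [add_right_comm] at hS' hmin
    have hw := forall_lt_of_min (w := w ++ w') (by simpa using hmin) (by simpa using hS')
    rw [List.forall_mem_append] at hw
    obtain ⟨hw, hw'⟩ := hw
    have hb := wordBlocks_append (a := (a, j)) (w := w) (w' := w') hw hw'
    refine Submodule.subset_span ⟨w ++ [(a, j)] ++ w', ?_, ?_, ?_, ?_⟩
    · simp only [List.map_append, ← Multiset.coe_add]
      rfl
    · simp [add_assoc]
    · rw [hb, List.length_cons, hlen]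
    · rw [normalMonomial, hb, List.map_cons, listProd_cons]
      · rfl
      · rw [ne_eq, List.map_eq_nil_iff, ← List.length_eq_zero_iff, hlen]
        omega

theorem isLie_rightNormed {b : List (ℕ × ℕ)} (hb : b ≠ []) :
    IsLie P x (b.map Prod.fst : List ℕ) (b.map Prod.snd).sum (P.rightNormed x b) := by
  induction b with
  | nil => exact absurd rfl hb
  | cons c w ih =>
    by_cases hw : w = []
    · subst hw
      simpa [rightNormed] using IsLie.letter c
    · rw [rightNormed_cons hw, List.map_cons, List.map_cons, List.sum_cons, ← Multiset.cons_coe,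
        ← Multiset.singleton_add]
      exact .brk (.letter c) (ih hw)

theorem isProd_listProd {b : List (ℕ × ℕ)} {l : List (List (ℕ × ℕ))} (hb : b ≠ [])
    (hl : ∀ b ∈ l, b ≠ []) : IsProd P x ((b :: l).flatten.map Prod.fst : List ℕ)
      ((b :: l).flatten.map Prod.snd).sum l.length
      (P.listProd ((b :: l).map (P.rightNormed x))) := by
  induction l generalizing b with
  | nil => simpa [listProd] using IsProd.lie (isLie_rightNormed (P := P) (x := x) hb)
  | cons b' l ih =>
    obtain ⟨hb', hl⟩ := List.forall_mem_cons.1 hl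
    rw [List.map_cons, listProd_cons (by simp), List.flatten_cons, List.map_append,
      List.map_append, List.sum_append, ← Multiset.coe_add]
    exact .mul (isLie_rightNormed hb) (ih hb' hl)

/-- The words with given letters that spell normal monomials of weight `-1`. -/
def _root_.normalWords (S : Multiset ℕ) : Set (List (ℕ × ℕ)) :=
  {w | ((w.map Prod.fst : List ℕ) : Multiset ℕ) = S ∧
    (w.map Prod.snd).sum + 1 = (wordBlocks w).length}

theorem normalMonomial_mem_weightSpan {S : Multiset ℕ} (hS : S.Nodup) {w : List (ℕ × ℕ)}
    (hw : w ∈ normalWords S) : P.normalMonomial x w ∈ P.weightSpan x S := by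
  obtain ⟨rfl, hw⟩ := hw
  have hne : ∀ b ∈ wordBlocks w, b ≠ [] := fun b hb => by
    obtain ⟨v, a, rfl, -⟩ := (wordBlocks_spec (Multiset.coe_nodup.1 hS)).1 b hb
    simp
  have hf := flatten_wordBlocks w
  obtain ⟨b, l, hbl⟩ := List.exists_cons_of_ne_nil (l := wordBlocks w) (fun h => by simp [h] at hw)
  rw [hbl] at hne hf hw
  have h := isProd_listProd (P := P) (x := x) (hne b (by simp)) fun b' hb' =>
    hne b' (List.mem_cons_of_mem _ hb')
  rw [hf, ← Nat.succ_injective hw, ← hbl] at h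
  exact Submodule.subset_span ⟨_, h⟩

/-- The multilinear part of the Gelfand--Dorfman subalgebra is spanned by normal monomials. -/
theorem gdSpan_eq_span_normalMonomial {S : Multiset ℕ} (hS : S.Nodup) :
    P.gdSpan x S = Submodule.span 𝕜 (P.normalMonomial x '' normalWords S) := by
  rw [gdSpan_eq_weightSpan]
  refine le_antisymm (Submodule.span_le.2 ?_) (Submodule.span_le.2 ?_)
  · rintro u ⟨m, hu⟩
    refine Submodule.span_mono ?_ (hu.mem_normalSpan hS)
    rintro _ ⟨w, h₁, h₂, h₃, rfl⟩
    exact ⟨w, ⟨h₁, by rw [h₂, h₃]⟩, rfl⟩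
  · rintro _ ⟨w, hw, rfl⟩
    exact normalMonomial_mem_weightSpan hS hw

end DiffPoissonAlgebra

/-! ### Linear independence in a polynomial algebra on words -/

namespace WordPoisson

open MvPolynomial

variable {𝕜 : Type u} [Field 𝕜]

variable (𝕜) in
/-- Polynomials in commuting variables indexed by words. -/
abbrev Carrier : Type u := MvPolynomial (List (ℕ × ℕ)) 𝕜

variable (𝕜) in
/-- The Poisson bracket determined by `{X u, X v} = X (u v) - X (v u)`, as a derivation in its first
argument with values in derivations. -/
noncomputable def poisson : Derivation 𝕜 (Carrier 𝕜) (Derivation 𝕜 (Carrier 𝕜) (Carrier 𝕜)) :=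
  mkDerivation 𝕜 fun u => mkDerivation 𝕜 fun v => X (u ++ v) - X (v ++ u)

theorem poisson_X_X (u v : List (ℕ × ℕ)) :
    poisson 𝕜 (X u) (X v) = X (u ++ v) - X (v ++ u) := by
  rw [poisson, mkDerivation_X, mkDerivation_X]

theorem poisson_mul_left (f g h : Carrier 𝕜) :
    poisson 𝕜 (f * g) h = f * poisson 𝕜 g h + g * poisson 𝕜 f h := by
  rw [Derivation.leibniz]
  rfl

theorem poisson_mul_right (f g h : Carrier 𝕜) :
    poisson 𝕜 f (g * h) = g * poisson 𝕜 f h + h * poisson 𝕜 f g := by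
  rw [Derivation.leibniz]
  rfl

theorem poisson_add_left (f g h : Carrier 𝕜) :
    poisson 𝕜 (f + g) h = poisson 𝕜 f h + poisson 𝕜 g h := by
  rw [map_add]
  rfl

theorem poisson_C_left (c : 𝕜) (h : Carrier 𝕜) : poisson 𝕜 (C c) h = 0 := by
  rw [derivation_C]
  rfl

theorem poisson_C_right (c : 𝕜) (h : Carrier 𝕜) : poisson 𝕜 h (C c) = 0 := derivation_C _ _

theorem poisson_antisymm (f g : Carrier 𝕜) : poisson 𝕜 f g = -poisson 𝕜 g f := by
  induction f using MvPolynomial.induction_on with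
  | C c => rw [poisson_C_left, poisson_C_right, neg_zero]
  | add f h hf hh => rw [poisson_add_left, map_add, hf, hh, neg_add]
  | mul_X f u hf =>
    have hX : poisson 𝕜 (X u) g = -poisson 𝕜 g (X u) := by
      clear hf
      induction g using MvPolynomial.induction_on with
      | C c => rw [poisson_C_left, poisson_C_right, neg_zero]
      | add g h hg hh => rw [poisson_add_left, map_add, hg, hh, neg_add]
      | mul_X g v hg =>
        rw [poisson_mul_left, poisson_mul_right, hg, poisson_X_X, poisson_X_X]
        ring
    rw [poisson_mul_left, poisson_mul_right, hf, hX]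
    ring

theorem poisson_self (f : Carrier 𝕜) : poisson 𝕜 f f = 0 := by
  induction f using MvPolynomial.induction_on with
  | C c => rw [poisson_C_left]
  | add f h hf hh =>
    rw [poisson_add_left, map_add, map_add, hf, hh, poisson_antisymm f h]
    ring
  | mul_X f u hf =>
    rw [poisson_mul_left, poisson_mul_right, poisson_mul_right, hf, poisson_X_X, sub_self,
      poisson_antisymm (X u) f]
    ring

/-- Leibniz in f and g reduces to two words. Then both sides are derivations in h, and on a third
word the identity is associativity of concatenation. -/
theorem poisson_poisson (f g h : Carrier 𝕜) : poisson 𝕜 (poisson 𝕜 f g) h =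
    poisson 𝕜 f (poisson 𝕜 g h) - poisson 𝕜 g (poisson 𝕜 f h) := by
  induction f using MvPolynomial.induction_on with
  | C c => simp only [poisson_C_left, map_zero, Derivation.zero_apply, sub_zero]
  | add f f' hf hf' =>
    simp only [map_add, Derivation.add_apply, hf, hf']
    ring
  | mul_X f u hf =>
    suffices hX : poisson 𝕜 (poisson 𝕜 (X u) g) h =
        poisson 𝕜 (X u) (poisson 𝕜 g h) - poisson 𝕜 g (poisson 𝕜 (X u) h) by
      simp only [poisson_mul_left, poisson_mul_right, map_add, Derivation.add_apply, hf, hX]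
      rw [poisson_antisymm g f, poisson_antisymm g (X u)]
      ring
    clear hf
    induction g using MvPolynomial.induction_on with
    | C c => simp only [poisson_C_left, poisson_C_right, map_zero, Derivation.zero_apply, sub_zero]
    | add g g' hg hg' =>
      simp only [map_add, Derivation.add_apply, hg, hg']
      ring
    | mul_X g v hg =>
      suffices hX : poisson 𝕜 (poisson 𝕜 (X u) (X v)) h =
          poisson 𝕜 (X u) (poisson 𝕜 (X v) h) - poisson 𝕜 (X v) (poisson 𝕜 (X u) h) by
        simp only [poisson_mul_left, poisson_mul_right, map_add, Derivation.add_apply, hg, hX]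
        ring
      have : poisson 𝕜 (poisson 𝕜 (X u) (X v)) = ⁅poisson 𝕜 (X u), poisson 𝕜 (X v)⁆ := by
        refine derivation_ext fun w => ?_
        simp only [Derivation.commutator_apply, poisson_X_X, map_sub, Derivation.sub_apply,
          List.append_assoc]
        ring
      rw [this, Derivation.commutator_apply]

/-- The words obtained by increasing the second index of one letter. -/
def bump : List (ℕ × ℕ) → List (List (ℕ × ℕ))
  | [] => []
  | c :: w => ((c.1, c.2 + 1) :: w) :: (bump w).map (c :: ·)

theorem bump_append (u v : List (ℕ × ℕ)) :
    bump (u ++ v) = (bump u).map (· ++ v) ++ (bump v).map (u ++ ·) := by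
  induction u with
  | nil => simp [bump]
  | cons c u ih => simp [bump, ih, Function.comp_def]

variable (𝕜) in
/-- The derivation that differentiates the letters of words. -/
noncomputable def der : Derivation 𝕜 (Carrier 𝕜) (Carrier 𝕜) :=
  mkDerivation 𝕜 fun u => ((bump u).map X).sum

theorem der_X (u : List (ℕ × ℕ)) : der 𝕜 (X u) = ((bump u).map X).sum := mkDerivation_X _ _ _

theorem poisson_sum_X (l : List (List (ℕ × ℕ))) (v : List (ℕ × ℕ)) :
    poisson 𝕜 ((l.map X).sum) (X v) =
      ((l.map (· ++ v)).map X).sum - ((l.map (v ++ ·)).map X).sum := by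
  induction l with
  | nil => simp
  | cons u l ih =>
    simp only [List.map_cons, List.sum_cons, poisson_add_left, ih, poisson_X_X]
    ring

/-- Leibniz reduces to words, where differentiating letters is a derivation of concatenation
(`bump_append`). -/
theorem der_poisson (f g : Carrier 𝕜) :
    der 𝕜 (poisson 𝕜 f g) = poisson 𝕜 (der 𝕜 f) g + poisson 𝕜 f (der 𝕜 g) := by
  have leib : ∀ a b : Carrier 𝕜, der 𝕜 (a * b) = a * der 𝕜 b + b * der 𝕜 a := fun a b => by
    rw [Derivation.leibniz]
    rfl
  induction f using MvPolynomial.induction_on with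
  | C c => simp only [derivation_C, map_zero, Derivation.zero_apply, add_zero]
  | add f f' hf hf' =>
    simp only [map_add, Derivation.add_apply, hf, hf']
    ring
  | mul_X f u hf =>
    suffices hX : der 𝕜 (poisson 𝕜 (X u) g) =
        poisson 𝕜 (der 𝕜 (X u)) g + poisson 𝕜 (X u) (der 𝕜 g) by
      simp only [poisson_mul_left, map_add, Derivation.add_apply, leib, hf, hX]
      ring
    clear hf
    induction g using MvPolynomial.induction_on with
    | C c => simp only [derivation_C, map_zero, add_zero]
    | add g g' hg hg' =>
      simp only [map_add, hg, hg']
      ring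
    | mul_X g v hg =>
      have hX : der 𝕜 (poisson 𝕜 (X u) (X v)) =
          poisson 𝕜 (der 𝕜 (X u)) (X v) + poisson 𝕜 (X u) (der 𝕜 (X v)) := by
        rw [poisson_antisymm (X u) (der 𝕜 (X v)), poisson_X_X, map_sub, der_X, der_X, der_X,
          der_X, bump_append, bump_append, poisson_sum_X, poisson_sum_X]
        simp only [List.map_append, List.sum_append]
        ring
      simp only [poisson_mul_right, map_add, leib, hg, hX]
      ring

variable (𝕜) in
/-- The differential Poisson algebra of polynomials in words. -/
noncomputable def algebra : DiffPoissonAlgebra 𝕜 (Carrier 𝕜) where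
  mul := LinearMap.mul 𝕜 (Carrier 𝕜)
  brk := LinearMap.mk₂ 𝕜 (fun f g => poisson 𝕜 f g) poisson_add_left
    (fun c f g => by rw [Derivation.map_smul]; rfl) (fun f g h => map_add _ _ _)
    (fun c f g => Derivation.map_smul _ _ _)
  d := (der 𝕜).toLinearMap
  mul_assoc f g h := _root_.mul_assoc f g h
  mul_comm f g := _root_.mul_comm f g
  brk_self := poisson_self
  jacobi f g h := by
    change poisson 𝕜 f (poisson 𝕜 g h) + poisson 𝕜 g (poisson 𝕜 h f) +
      poisson 𝕜 h (poisson 𝕜 f g) = 0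
    rw [poisson_antisymm h (poisson 𝕜 f g), poisson_poisson, poisson_antisymm h f, map_neg]
    ring
  leibniz f g h := by
    change poisson 𝕜 f (g * h) = poisson 𝕜 f g * h + g * poisson 𝕜 f h
    rw [poisson_mul_right]
    ring
  d_mul f g := by
    change der 𝕜 (f * g) = der 𝕜 f * g + f * der 𝕜 g
    rw [Derivation.leibniz, smul_eq_mul, smul_eq_mul]
    ring
  d_brk := der_poisson

variable (𝕜) in
/-- The generators of the algebra of polynomials in words. -/
noncomputable def gen (i : ℕ) : Carrier 𝕜 := X [(i, 0)]

theorem letter_eq (c : ℕ × ℕ) : (algebra 𝕜).letter (gen 𝕜) c = X [c] := by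
  obtain ⟨i, j⟩ := c
  induction j with
  | zero => rfl
  | succ j ih =>
    rw [DiffPoissonAlgebra.letter_succ, ih]
    change der 𝕜 (X [(i, j)]) = _
    simp [der_X, bump]

variable (𝕜) in
/-- The span of words that contain the letter `a` and whose last letter is larger than `a`. -/
noncomputable def tailSpan (a : ℕ × ℕ) : Submodule 𝕜 (Carrier 𝕜) :=
  Submodule.span 𝕜 {f | ∃ v y, a ∈ v ∧ a.1 < y.1 ∧ f = X (v ++ [y])}

theorem poisson_X_mem_tailSpan {a c : ℕ × ℕ} (hc : a.1 < c.1) {f : Carrier 𝕜}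
    (hf : f ∈ tailSpan 𝕜 a) : poisson 𝕜 (X [c]) f ∈ tailSpan 𝕜 a := by
  refine DiffPoissonAlgebra.lin_mem_of_mem_span (D := (poisson 𝕜 (X [c])).toLinearMap) ?_ hf
  rintro _ ⟨v, y, hv, hy, rfl⟩
  change poisson 𝕜 (X [c]) (X (v ++ [y])) ∈ _
  rw [poisson_X_X]
  refine sub_mem (Submodule.subset_span ⟨c :: v, y, List.mem_cons_of_mem _ hv, hy, rfl⟩)
    (Submodule.subset_span ⟨v ++ [y], c, List.mem_append_left _ hv, hc, rfl⟩)

/-- In the expanded nested commutator, every word other than v a has some letter of v placed after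
a, so it ends in a letter larger than a. -/
theorem rightNormed_sub_mem {a : ℕ × ℕ} {v : List (ℕ × ℕ)} (hv : ∀ y ∈ v, a.1 < y.1) :
    (algebra 𝕜).rightNormed (gen 𝕜) (v ++ [a]) - X (v ++ [a]) ∈ tailSpan 𝕜 a := by
  induction v with
  | nil =>
    have : (algebra 𝕜).rightNormed (gen 𝕜) ([] ++ [a]) = X [a] := letter_eq a
    rw [this, List.nil_append, sub_self]
    exact zero_mem _
  | cons c v ih =>
    obtain ⟨hc, hv⟩ := List.forall_mem_cons.1 hv
    have h := poisson_X_mem_tailSpan hc (ih hv)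
    rw [map_sub, poisson_X_X] at h
    rw [List.cons_append, DiffPoissonAlgebra.rightNormed_cons (by simp), letter_eq]
    have h' : (X (v ++ [a] ++ [c]) : Carrier 𝕜) ∈ tailSpan 𝕜 a :=
      Submodule.subset_span ⟨v ++ [a], c, by simp, hc, rfl⟩
    convert sub_mem h h' using 1
    change poisson 𝕜 (X [c]) _ - _ = _
    rw [List.singleton_append]
    ring

open Classical in
variable (𝕜) in
/-- The algebra homomorphism that keeps the words which end with their minimum and kills all other
words. -/
noncomputable def leading : Carrier 𝕜 →ₐ[𝕜] Carrier 𝕜 :=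
  aeval fun u => if EndsWithMin u then X u else 0

theorem leading_tailSpan {a : ℕ × ℕ} {f : Carrier 𝕜} (hf : f ∈ tailSpan 𝕜 a) :
    leading 𝕜 f = 0 := by
  refine DiffPoissonAlgebra.lin_mem_of_mem_span (D := (leading 𝕜).toLinearMap) (p := ⊥) ?_ hf
  rintro _ ⟨v, y, hv, hy, rfl⟩
  change leading 𝕜 (X (v ++ [y])) = 0
  rw [leading, aeval_X, if_neg]
  rintro ⟨v', a', h, hlt⟩
  obtain ⟨rfl, h⟩ := List.append_inj' h rfl
  obtain rfl : y = a' := by simpa using h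
  exact lt_asymm hy (hlt a hv)

theorem leading_rightNormed {b : List (ℕ × ℕ)} (hb : EndsWithMin b) :
    leading 𝕜 ((algebra 𝕜).rightNormed (gen 𝕜) b) = X b := by
  obtain ⟨v, a, rfl, hv⟩ := hb
  have h := leading_tailSpan (rightNormed_sub_mem (𝕜 := 𝕜) hv)
  rw [map_sub, sub_eq_zero] at h
  rw [h, leading, aeval_X, if_pos ⟨v, a, rfl, hv⟩]

theorem listProd_eq {l : List (Carrier 𝕜)} (hl : l ≠ []) : (algebra 𝕜).listProd l = l.prod := by
  induction l with
  | nil => exact absurd rfl hl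
  | cons a l ih =>
    by_cases h : l = []
    · subst h
      simp [DiffPoissonAlgebra.listProd]
    · rw [DiffPoissonAlgebra.listProd_cons h, ih h, List.prod_cons]
      rfl

theorem list_prod_X (l : List (List (ℕ × ℕ))) :
    (l.map (X (R := 𝕜))).prod = monomial (Multiset.toFinsupp (l : Multiset (List (ℕ × ℕ)))) 1 := by
  induction l with
  | nil => simp
  | cons b l ih =>
    rw [List.map_cons, List.prod_cons, ih, ← Multiset.cons_coe, ← Multiset.singleton_add, map_add,
      Multiset.toFinsupp_singleton, X, monomial_mul, one_mul]

/-- As `leading` is multiplicative, it turns the product over the blocks into the commutative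
monomial recording their multiset. Distinct words give distinct multisets by
`eq_of_wordBlocks_perm`. -/
theorem leading_normalMonomial {w : List (ℕ × ℕ)} (hw : (w.map Prod.fst).Nodup) (hne : w ≠ []) :
    leading 𝕜 ((algebra 𝕜).normalMonomial (gen 𝕜) w) =
      monomial (Multiset.toFinsupp (wordBlocks w : Multiset (List (ℕ × ℕ)))) 1 := by
  rw [DiffPoissonAlgebra.normalMonomial, listProd_eq (by simpa using wordBlocks_ne_nil hne),
    map_list_prod, List.map_map, ← list_prod_X]
  congr 1
  exact List.map_congr_left fun b hb => leading_rightNormed ((wordBlocks_spec hw).1 b hb)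

theorem linearIndependent_normalMonomial {S : Multiset ℕ} (hS : S.Nodup) :
    LinearIndependent 𝕜
      (fun w : normalWords S => (algebra 𝕜).normalMonomial (gen 𝕜) (w : List (ℕ × ℕ))) := by
  have hnd : ∀ w : normalWords S, ((w : List (ℕ × ℕ)).map Prod.fst).Nodup := fun w => by
    rw [← Multiset.coe_nodup, w.2.1]
    exact hS
  have hne : ∀ w : normalWords S, (w : List (ℕ × ℕ)) ≠ [] := fun w h => by
    have := w.2.2
    rw [h] at this
    simp [wordBlocks] at this
  have hinj : Function.Injective (fun w : normalWords S =>
      Multiset.toFinsupp (wordBlocks (w : List (ℕ × ℕ)) : Multiset (List (ℕ × ℕ)))) := by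
    intro w w' h
    exact Subtype.ext (eq_of_wordBlocks_perm (hnd w) (hnd w')
      (Multiset.coe_eq_coe.1 (Multiset.toFinsupp.injective h)))
  have h := (basisMonomials (List (ℕ × ℕ)) 𝕜).linearIndependent
  rw [coe_basisMonomials] at h
  refine LinearIndependent.of_comp (leading 𝕜).toLinearMap ?_
  have he : ((leading 𝕜).toLinearMap ∘ fun w : normalWords S =>
      (algebra 𝕜).normalMonomial (gen 𝕜) (w : List (ℕ × ℕ))) =
      (fun s => monomial s 1) ∘ fun w : normalWords S =>
      Multiset.toFinsupp (wordBlocks (w : List (ℕ × ℕ)) : Multiset (List (ℕ × ℕ))) :=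
    funext fun w => by
      rw [Function.comp_apply, Function.comp_apply, AlgHom.toLinearMap_apply]
      exact leading_normalMonomial (hnd w) (hne w)
  rw [he]
  exact h.comp _ hinj

end WordPoisson

/-! ### Transfer to the free algebra and the dimension as a count -/

namespace DiffPoissonAlgebra

variable {𝕜 V W : Type u} [Field 𝕜] [AddCommGroup V] [Module 𝕜 V] [AddCommGroup W] [Module 𝕜 W]
  {P : DiffPoissonAlgebra 𝕜 V} {Q : DiffPoissonAlgebra 𝕜 W} {f : V →ₗ[𝕜] W}

theorem IsHom.map_letter (hf : P.IsHom Q f) (x : ℕ → V) (c : ℕ × ℕ) :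
    f (P.letter x c) = Q.letter (fun i => f (x i)) c := by
  obtain ⟨i, j⟩ := c
  induction j with
  | zero => rfl
  | succ j ih => rw [letter_succ, letter_succ, hf.map_d, ih]

theorem IsHom.map_rightNormed (hf : P.IsHom Q f) (x : ℕ → V) (w : List (ℕ × ℕ)) :
    f (P.rightNormed x w) = Q.rightNormed (fun i => f (x i)) w := by
  induction w with
  | nil => exact map_zero f
  | cons c w ih =>
    by_cases hw : w = []
    · subst hw
      exact hf.map_letter x c
    · rw [rightNormed_cons hw, rightNormed_cons hw, hf.map_brk, ih, hf.map_letter]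

theorem IsHom.map_listProd (hf : P.IsHom Q f) (l : List V) :
    f (P.listProd l) = Q.listProd (l.map f) := by
  induction l with
  | nil => exact map_zero f
  | cons a l ih =>
    by_cases hl : l = []
    · subst hl
      rfl
    · rw [listProd_cons hl, List.map_cons, listProd_cons (by simpa using hl), hf.map_mul, ih]

theorem IsHom.map_normalMonomial (hf : P.IsHom Q f) (x : ℕ → V) (w : List (ℕ × ℕ)) :
    f (P.normalMonomial x w) = Q.normalMonomial (fun i => f (x i)) w := by
  rw [normalMonomial, hf.map_listProd, List.map_map, normalMonomial]
  congr 1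
  exact List.map_congr_left fun b _ => hf.map_rightNormed x b

end DiffPoissonAlgebra

theorem FreeDP.linearIndependent_normalMonomial {𝕜 : Type u} [Field 𝕜] {S : Multiset ℕ}
    (hS : S.Nodup) : LinearIndependent 𝕜
      (fun w : normalWords S => (algebra 𝕜).normalMonomial gen (w : List (ℕ × ℕ))) := by
  refine LinearIndependent.of_comp (lift (WordPoisson.algebra 𝕜) (WordPoisson.gen 𝕜)) ?_
  have h := WordPoisson.linearIndependent_normalMonomial (𝕜 := 𝕜) hS
  simpa only [Function.comp_def, (isHom_lift _ _).map_normalMonomial, lift_gen] using h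

/-- The dimension of the `n`-th component of the operad is the number of normal words. -/
theorem finrank_SGD_eq_card {𝕜 : Type u} [Field 𝕜] (n : ℕ) :
    Module.finrank 𝕜 (SGD 𝕜 n) = Nat.card (normalWords (Multiset.range n)) := by
  set ev := GDPolynomial.eval (FreeDP.algebra 𝕜).toGD FreeDP.gen with hev
  have hker : (GDPolynomial.idealSGD 𝕜).comap (GDPolynomial.multilinear 𝕜 n).subtype =
      LinearMap.ker (ev ∘ₗ (GDPolynomial.multilinear 𝕜 n).subtype) := by
    ext p
    exact GDPolynomial.mem_idealSGD_iff _
  -- The image of the multilinear polynomials under evaluation is `gdSpan`, hence the span of the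
  -- normal monomials.
  have hrange : LinearMap.range (ev ∘ₗ (GDPolynomial.multilinear 𝕜 n).subtype) =
      Submodule.span 𝕜 (Set.range fun w : normalWords (Multiset.range n) =>
        (FreeDP.algebra 𝕜).normalMonomial FreeDP.gen (w : List (ℕ × ℕ))) := by
    rw [LinearMap.range_comp, Submodule.range_subtype, ← Set.image_eq_range,
      ← DiffPoissonAlgebra.gdSpan_eq_span_normalMonomial (Multiset.nodup_range n)]
    exact (Finsupp.span_image_eq_map_linearCombination 𝕜 _).symm
  rw [(Submodule.quotEquivOfEq _ _ hker).finrank_eq,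
    (LinearMap.quotKerEquivRange _).finrank_eq, hrange,
    Module.finrank_eq_nat_card_basis
      (Module.Basis.span (FreeDP.linearIndependent_normalMonomial (Multiset.nodup_range n)))]

/-! ### Counting normal words -/

/-- The number of right-to-left minima of a list. -/
def minimaCount : List ℕ → ℕ
  | [] => 0
  | a :: l => (if ∀ b ∈ l, a < b then 1 else 0) + minimaCount l

theorem length_wordBlocks (w : List (ℕ × ℕ)) :
    (wordBlocks w).length = minimaCount (w.map Prod.fst) := by
  induction w with
  | nil => rfl
  | cons c w ih =>
    rw [List.map_cons, minimaCount, ← ih]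
    by_cases h : ∀ y ∈ w, c.1 < y.1
    · rw [if_pos (List.forall_mem_map.2 h), wordBlocks_cons_of_lt h, List.length_cons, add_comm]
    · obtain ⟨b, l, h₁, h₂⟩ := wordBlocks_cons_of_not_lt h
      rw [if_neg (fun h' => h (List.forall_mem_map.1 h')), h₁, h₂, List.length_cons,
        List.length_cons, zero_add]

/-- The lists without repetitions whose entries form a given finite set. -/
def orderings (S : Finset ℕ) : Finset (List ℕ) := ⟨S.val.lists, Multiset.lists_nodup_finset S⟩

theorem mem_orderings {S : Finset ℕ} {l : List ℕ} : l ∈ orderings S ↔ (l : Multiset ℕ) = S.val := by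
  rw [orderings, Finset.mem_mk, Multiset.mem_lists_iff]
  exact eq_comm

theorem sum_orderings {M : Type*} [AddCommMonoid M] {S : Finset ℕ} (hS : S.Nonempty)
    (g : List ℕ → M) :
    ∑ l ∈ orderings S, g l = ∑ c ∈ S, ∑ l ∈ orderings (S.erase c), g (c :: l) := by
  rw [Finset.sum_sigma']
  symm
  refine Finset.sum_bij (fun p _ => p.1 :: p.2) ?_ ?_ ?_ (fun _ _ => rfl)
  · rintro ⟨c, l⟩ h
    obtain ⟨hc, hl⟩ := Finset.mem_sigma.1 h
    rw [mem_orderings] at hl ⊢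
    dsimp only at hc hl ⊢
    rw [← Multiset.cons_coe, hl, Finset.erase_val, Multiset.cons_erase hc]
  · rintro ⟨c, l⟩ - ⟨c', l'⟩ - h
    obtain ⟨rfl, rfl⟩ := List.cons.inj h
    rfl
  · intro l hl
    rw [mem_orderings] at hl
    cases l with
    | nil => exact absurd (Finset.val_eq_zero.1 hl.symm) hS.ne_empty
    | cons c l =>
      refine ⟨⟨c, l⟩, Finset.mem_sigma.2 ⟨?_, ?_⟩, rfl⟩
      · rw [← Finset.mem_val, ← hl]
        simp
      · rw [mem_orderings, Finset.erase_val, ← hl]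
        simp

/-- The Stirling recurrence summed against a weight g. The index shift in `h` costs nothing, since n
c(n,0) = 0 and c(n,n+1) = 0. -/
theorem sum_stirlingFirst_succ (n : ℕ) (g : ℕ → ℕ) :
    ∑ k ∈ Finset.range (n + 2), Nat.stirlingFirst (n + 1) k * g k =
      ∑ k ∈ Finset.range (n + 1), Nat.stirlingFirst n k * g (k + 1) +
        n * ∑ k ∈ Finset.range (n + 1), Nat.stirlingFirst n k * g k := by
  have h : n * ∑ k ∈ Finset.range (n + 1), Nat.stirlingFirst n k * g k =
      n * ∑ k ∈ Finset.range (n + 1), Nat.stirlingFirst n (k + 1) * g (k + 1) := by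
    cases n with
    | zero => simp
    | succ n =>
      rw [Finset.sum_range_succ', Finset.sum_range_succ (n := n + 1),
        Nat.stirlingFirst_succ_zero, Nat.stirlingFirst_eq_zero_of_lt (Nat.lt_succ_self (n + 1))]
      simp
  rw [Finset.sum_range_succ', Nat.stirlingFirst_succ_zero, zero_mul, add_zero, h, Finset.mul_sum,
    ← Finset.sum_add_distrib]
  refine Finset.sum_congr rfl fun k _ => ?_
  rw [Nat.stirlingFirst_succ_succ]
  ring

/-- The distribution of the number of right-to-left minima is given by the Stirling numbers of the
first kind. -/
theorem sum_orderings_minimaCount (n : ℕ) : ∀ (S : Finset ℕ), S.card = n → ∀ g : ℕ → ℕ,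
    ∑ l ∈ orderings S, g (minimaCount l) =
      ∑ k ∈ Finset.range (n + 1), Nat.stirlingFirst n k * g k := by
  induction n with
  | zero =>
    intro S hS g
    obtain rfl := Finset.card_eq_zero.1 hS
    have : orderings ∅ = {[]} := by
      ext l
      rw [mem_orderings]
      simp
    rw [this]
    simp [minimaCount]
  | succ n ih =>
    intro S hS g
    have hne : S.Nonempty := Finset.card_pos.1 (by omega)
    have hm := S.min'_mem hne
    -- Split by the first entry: it is a right-to-left minimum only if it is the least element of S;
    -- the n other choices leave the count unchanged.
    rw [sum_orderings hne, ← Finset.add_sum_erase _ _ hm, sum_stirlingFirst_succ]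
    congr 1
    · rw [← ih (S.erase (S.min' hne)) (by rw [Finset.card_erase_of_mem hm, hS]; rfl)
        (fun k => g (k + 1))]
      refine Finset.sum_congr rfl fun l hl => ?_
      rw [mem_orderings] at hl
      rw [minimaCount, if_pos, add_comm]
      intro b hb
      rw [← Multiset.mem_coe, hl, Finset.mem_val] at hb
      exact S.min'_lt_of_mem_erase_min' hne hb
    · have hc : (S.erase (S.min' hne)).card = n := by
        rw [Finset.card_erase_of_mem hm, hS]
        rfl
      refine (Finset.sum_congr rfl fun c hcS => ?_).trans
        (by rw [Finset.sum_const, hc, smul_eq_mul])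
      have hcS' := Finset.mem_of_mem_erase hcS
      rw [← ih (S.erase c) (by rw [Finset.card_erase_of_mem hcS', hS]; rfl) g]
      refine Finset.sum_congr rfl fun l hl => ?_
      rw [mem_orderings] at hl
      rw [minimaCount, if_neg, zero_add]
      intro h
      have hmem : S.min' hne ∈ l := by
        rw [← Multiset.mem_coe, hl, Finset.mem_val, Finset.mem_erase]
        exact ⟨(Finset.ne_of_mem_erase hcS).symm, hm⟩
      exact absurd (h _ hmem) (not_lt.2 (S.min'_le c hcS'))

theorem minimaCount_pos {l : List ℕ} (hl : l ≠ []) : 0 < minimaCount l := by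
  induction l with
  | nil => exact absurd rfl hl
  | cons a l ih =>
    rw [minimaCount]
    by_cases h : l = []
    · simp [h]
    · exact Nat.add_pos_right _ (ih h)

/-- A normal word is an ordering of the generators together with exponents on the n letters whose
sum is one less than the number of minima. -/
theorem card_normalWords {n : ℕ} (hn : 1 ≤ n) : Nat.card (normalWords (Multiset.range n)) =
    ∑ k ∈ Finset.range (n + 1), Nat.stirlingFirst n k * (n + k - 2).choose (k - 1) := by
  classical
  have hlen : ∀ l ∈ orderings (Finset.range n), l.length = n := fun l hl => by
    rw [mem_orderings] at hl
    rw [← Multiset.coe_card, hl]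
    simp
  have hset : normalWords (Multiset.range n) =
      (((orderings (Finset.range n)).sigma fun l =>
        (Finset.univ : Finset (Fin n)).finsuppAntidiag (minimaCount l - 1)).image
        fun p => p.1.zip (List.ofFn p.2) : Finset (List (ℕ × ℕ))) := by
    ext w
    simp only [Finset.coe_image, Set.mem_image, Finset.mem_coe, Finset.mem_sigma,
      Finset.mem_finsuppAntidiag, Finset.subset_univ, and_true, normalWords, Set.mem_ofPred_eq,
      length_wordBlocks]
    constructor
    · rintro ⟨h₁, h₂⟩
      have hl : (w.map Prod.fst) ∈ orderings (Finset.range n) := mem_orderings.2 h₁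
      have hw : (w.map Prod.snd).length = n := by simpa using hlen _ hl
      obtain ⟨f, hf⟩ : ∃ f : Fin n → ℕ, List.ofFn f = w.map Prod.snd := by
        subst hw
        exact ⟨_, List.ofFn_get _⟩
      refine ⟨⟨w.map Prod.fst, Finsupp.equivFunOnFinite.symm f⟩, ⟨hl, ?_⟩, ?_⟩
      · simp only [Finsupp.coe_equivFunOnFinite_symm]
        rw [← List.sum_ofFn, hf, ← h₂, Nat.add_sub_cancel]
      · simp only [Finsupp.coe_equivFunOnFinite_symm, hf]
        have := List.zip_unzip w
        rwa [List.unzip_eq_map] at this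
    · rintro ⟨⟨l, j⟩, ⟨hl, hj⟩, rfl⟩
      dsimp only at hl hj ⊢
      rw [List.map_fst_zip (by simp [hlen l hl]), List.map_snd_zip (by simp [hlen l hl]),
        List.sum_ofFn, hj]
      refine ⟨mem_orderings.1 hl, Nat.sub_add_cancel (minimaCount_pos ?_)⟩
      rintro rfl
      have := hlen _ hl
      simp at this
      omega
  rw [hset, Nat.card_coe_set_eq, Set.ncard_coe_finset, Finset.card_image_of_injOn,
    Finset.card_sigma]
  · simp only [Finset.card_finsuppAntidiag_nat_eq_choose, Finset.card_univ, Fintype.card_fin]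
    rw [sum_orderings_minimaCount n _ (Finset.card_range n) fun k => (n + (k - 1) - 1).choose (k - 1)]
    refine Finset.sum_congr rfl fun k _ => ?_
    rcases Nat.eq_zero_or_pos k with rfl | hk
    -- For k = 0 the truncated k-1 is 0, so both binomials equal 1.
    · simp
    · rw [← Nat.add_sub_assoc hk, Nat.sub_sub]
  · rintro ⟨l, j⟩ h ⟨l', j'⟩ h' he
    have hl := hlen l (Finset.mem_sigma.1 (Finset.mem_coe.1 h)).1
    have hl' := hlen l' (Finset.mem_sigma.1 (Finset.mem_coe.1 h')).1
    dsimp only at he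
    have h₁ := congrArg (List.map Prod.fst) he
    have h₂ := congrArg (List.map Prod.snd) he
    rw [List.map_fst_zip (by simp [hl]), List.map_fst_zip (by simp [hl'])] at h₁
    rw [List.map_snd_zip (by simp [hl]), List.map_snd_zip (by simp [hl'])] at h₂
    obtain rfl := h₁
    obtain rfl := DFunLike.coe_injective (List.ofFn_injective h₂)
    rfl

/-! ### Stirling numbers in terms of H, and the final formula -/

theorem sgdH_zero_right_one (n : ℕ) : sgdH n 1 = 1 := by
  simp [sgdH]

/-- Split the subsets of {1,…,n} by whether they contain n, which contributes the factor 1/n. -/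
theorem sgdH_succ (n k : ℕ) (hn : 1 ≤ n) :
    sgdH (n + 1) (k + 2) = sgdH n (k + 2) + sgdH n (k + 1) / n := by
  obtain ⟨m, rfl⟩ := Nat.exists_eq_add_of_le' hn
  have hI : Finset.Icc 1 (m + 1) = insert (m + 1) (Finset.Icc 1 m) :=
    (Finset.insert_Icc_right_eq_Icc_add_one (by omega)).symm
  simp only [sgdH, Nat.add_sub_cancel, Nat.add_succ_sub_one]
  rw [hI, Finset.powersetCard_succ_insert (by simp), Finset.sum_union, Finset.sum_image,
    Finset.sum_div]
  · congr 1
    refine Finset.sum_congr rfl fun s hs => ?_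
    rw [Finset.prod_insert, mul_comm, mul_one_div]
    intro h
    have := (Finset.mem_powersetCard.1 hs).1 h
    simp at this
  · intro s hs s' hs' h
    have hm : ∀ {s}, s ∈ (Finset.powersetCard k (Finset.Icc 1 m) : Set (Finset ℕ)) → m + 1 ∉ s :=
      fun hs h => by simpa using (Finset.mem_powersetCard.1 (Finset.mem_coe.1 hs)).1 h
    rw [← Finset.erase_insert (hm hs), ← Finset.erase_insert (hm hs')]
    exact congrArg (Finset.erase · (m + 1)) h
  · rw [Finset.disjoint_left]
    intro s hs hs'
    obtain ⟨s', -, rfl⟩ := Finset.mem_image.1 hs'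
    simpa using (Finset.mem_powersetCard.1 hs).1 (Finset.mem_insert_self _ _)

/-- After scaling by the factorial, `sgdH_succ` becomes the Stirling recurrence. -/
theorem stirlingFirst_eq_sgdH (n : ℕ) : ∀ k, (Nat.stirlingFirst (n + 1) (k + 1) : ℚ) =
    n.factorial * sgdH (n + 1) (k + 1) := by
  induction n with
  | zero =>
    intro k
    cases k with
    | zero => simp [sgdH, Nat.stirlingFirst]
    | succ k =>
      have : Finset.powersetCard (k + 1) (∅ : Finset ℕ) = ∅ :=
        Finset.powersetCard_eq_empty.2 (Nat.succ_pos k)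
      simp [sgdH, Nat.stirlingFirst, this]
  | succ n ih =>
    intro k
    cases k with
    | zero =>
      rw [Nat.stirlingFirst_succ_succ, Nat.stirlingFirst_succ_zero, add_zero, Nat.cast_mul, ih,
        sgdH_zero_right_one, sgdH_zero_right_one, Nat.factorial_succ]
      push_cast
      ring
    | succ k =>
      rw [Nat.stirlingFirst_succ_succ, Nat.cast_add, Nat.cast_mul, ih, ih,
        sgdH_succ _ _ (Nat.succ_pos n), Nat.factorial_succ]
      have : (n + 1 : ℚ) ≠ 0 := by positivity
      push_cast
      field_simp

theorem finrank_SGD {𝕜 : Type u} [Field 𝕜] {n : ℕ} (hn : 1 ≤ n) :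
    Module.finrank 𝕜 (SGD 𝕜 n) =
      ∑ k ∈ Finset.range (n + 1), Nat.stirlingFirst n k * (n + k - 2).choose (k - 1) :=
  (finrank_SGD_eq_card n).trans (card_normalWords hn)

theorem mainTheorem8 (𝕜 : Type u) [Field 𝕜] :
    (∀ n : ℕ, 1 ≤ n →
      (Module.finrank 𝕜 (SGD 𝕜 n) : ℚ) =
        ∑ k ∈ Finset.Icc 1 n,
          ((Nat.factorial (n + k - 2) : ℚ) / (Nat.factorial (k - 1) : ℚ)) * sgdH n k) ∧
    Module.finrank 𝕜 (SGD 𝕜 1) = 1 ∧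
    Module.finrank 𝕜 (SGD 𝕜 2) = 3 ∧
    Module.finrank 𝕜 (SGD 𝕜 3) = 17 ∧
    Module.finrank 𝕜 (SGD 𝕜 4) = 130 ∧
    Module.finrank 𝕜 (SGD 𝕜 5) = 1219 ∧
    Module.finrank 𝕜 (SGD 𝕜 6) = 13391 ∧
    Module.finrank 𝕜 (SGD 𝕜 7) = 167656 := by
  refine ⟨fun n hn => ?_, ?_⟩
  · obtain ⟨m, rfl⟩ := Nat.exists_eq_add_of_le' hn
    rw [finrank_SGD hn, Finset.sum_range_succ', Nat.stirlingFirst_succ_zero, zero_mul, add_zero,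
      Nat.cast_sum, ← Finset.Ico_add_one_right_eq_Icc, Finset.sum_Ico_eq_sum_range]
    refine Finset.sum_congr rfl fun j _ => ?_
    rw [Nat.cast_mul, stirlingFirst_eq_sgdH, add_comm 1 j, Nat.add_sub_cancel,
      show m + 1 + (j + 1) - 2 = m + j by omega, Nat.cast_choose ℚ (Nat.le_add_left j m),
      Nat.add_sub_cancel]
    -- The m! of the Stirling number cancels the m! in the denominator of C(m+j,j).
    have := Nat.cast_ne_zero (R := ℚ).2 m.factorial_ne_zero
    field_simp
  · refine ⟨?_, ?_, ?_, ?_, ?_, ?_, ?_⟩ <;> rw [finrank_SGD (by norm_num)] <;> decide
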